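/- **Definitions.** A clustering of a finite metric space $(X,d)$, $|X|=n$, is a partition of $X$ into $k\ge 1$ non-empty clusters $C_1,\dots,C_k$; an objective $\mathcal H$ assigns a real cost $\mathcal H(C_1,\dots,C_k;d)$, to be minimized, to a clustering and a metric on $X$. The objective $\mathcal H$ is a *natural center-based objective* if, for some functions $f_c$ ($c\in X$) and $g_u(r)$ ($u\in X$, $r\in\mathbb R$), $$\mathcal H(C_1,\dots,C_k;d)=\min_{c_i\in C_i}\sum_{i=1}^k\Big(f_{c_i}+\sum_{u\in C_i}g_u(d(u,c_i))\Big)$$ or $$\mathcal H(C_1,\dots,C_k;d)=\min_{c_i\in C_i}\max\Big(\max_{i}f_{c_i},\ \max_{i,\;u\in C_i}g_u(d(u,c_i))\Big),$$ and if it is center-based: for every metric $d$ on $X$ there are an optimal clustering $C_1,\dots,C_k$ and centers $c_i\in C_i$ attaining the minimum above such that $d(u,c_i)\le d(u,c_j)$ for all $i,j$ and all $u\in C_i$ (this holds for instance whenever all $g_u$ are non-decreasing on $[0,\infty)$). An instance $((X,d),\mathcal H,k)$ is *2-metric perturbation resilient* if it has an optimal clustering that is the unique optimal clustering of $((X,d'),\mathcal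 H,k)$ for every metric $d'$ on $X$ with $d(u,v)\le d'(u,v)\le 2d(u,v)$ for all $u,v\in X$. **Theorem.** There is a polynomial-time algorithm that, given any 2-metric perturbation resilient instance $((X,d),\mathcal H,k)$ of a clustering problem with natural center-based objective, returns the (unique) optimal clustering of $X$. Precisely, there are one program and one polynomial $T$ such that on every such instance the program halts with the optimal clustering after at most $T(n)$ steps. Here programs are random access programs on natural and real numbers, in which every addition, subtraction (truncated at zero for natural numbers), comparison, memory access and query of the input counts as a step; there are no other arithmetic operations. The input consists of $n$, $k$, which of the two forms the objective has, and the values $d(u,v)$, $f_c$ and $g_u(d(u,c))$ for $u,v,c\in X$, which can be queried one at a time. Moreover, for $1\le k\le n$ the following are natural center-based objectives: $k$-means, $k$-median and $k$-center, that is, the minimum over all choices of centers $c_i\in C_i$ of $\sum_i\sum_{u\in C_i}d(u,c_i)^2$, of $\sum_i\sum_{u\in C_i}d(u,c_i)$ and of $\max_i\max_{u\in C_i}d(u,c_i)$, respectively; and metric facility location with arbitrary opening costs $f_c$, that is, the minimum of $\sum_i f_{c_i}+\sum_i\sum_{u\in C_i}d(u,c_i)$. -/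

import Mathlib

namespace Clustering

/-! ## Clusterings, objectives and metric perturbation resilience -/

/-- `d` is a metric on the finite set of points `{0, …, n - 1}`. -/
structure IsMetric {n : ℕ} (d : Fin n → Fin n → ℝ) : Prop where
  eq_zero_iff : ∀ u v, d u v = 0 ↔ u = v
  symm : ∀ u v, d u v = d v u
  triangle : ∀ u v w, d u w ≤ d u v + d v w

/-- A partition of the `n` points into `k` nonempty clusters `C_i = {u | C u = i}`. -/
def IsClustering {n k : ℕ} (C : Fin n → Fin k) : Prop :=
  Function.Surjective C

/-- Two labelings define the same partition (they agree up to the names of the clusters). -/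
def SamePartition {n k : ℕ} (C C' : Fin n → Fin k) : Prop :=
  ∀ u v, C u = C v ↔ C' u = C' v

/-- A clustering objective: it assigns a cost to a clustering and a metric. -/
abbrev Objective (n k : ℕ) : Type :=
  (Fin n → Fin k) → (Fin n → Fin n → ℝ) → ℝ

/-- `C` is an optimal clustering for the distances `d`. -/
def IsOptimal {n k : ℕ} (H : Objective n k) (d : Fin n → Fin n → ℝ) (C : Fin n → Fin k) : Prop :=
  IsClustering C ∧ ∀ C', IsClustering C' → H C d ≤ H C' d

/-- `d'` is a metric `α`-perturbation of `d`. -/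
def IsMetricPerturbation {n : ℕ} (α : ℝ) (d d' : Fin n → Fin n → ℝ) : Prop :=
  IsMetric d' ∧ ∀ u v, d u v ≤ d' u v ∧ d' u v ≤ α * d u v

/-- The instance has an optimal clustering which is, up to the names of the clusters, the unique
optimal clustering for every metric `α`-perturbation of `d`. -/
def IsMetricPerturbationResilient {n k : ℕ} (α : ℝ) (H : Objective n k)
    (d : Fin n → Fin n → ℝ) : Prop :=
  ∃ C, IsOptimal H d C ∧ ∀ d', IsMetricPerturbation α d d' →
    IsOptimal H d' C ∧ ∀ C', IsOptimal H d' C' → SamePartition C C'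

/-! ## Natural center-based objectives -/

/-- A choice of centers `c i ∈ C_i`. -/
abbrev Centers {n k : ℕ} (C : Fin n → Fin k) : Type :=
  {c : Fin k → Fin n // ∀ i, C (c i) = i}

/-- How the individual costs are combined: by their sum or by their maximum. -/
inductive Kind
  | total
  | bottleneck

/-- The data of a natural center-based objective: the cost `f c` of having a center at `c` and the
cost `g u r` of connecting `u` to a center at distance `r` from `u`. -/
structure CostData (n : ℕ) where
  kind : Kind
  f : Fin n → ℝ
  g : Fin n → ℝ → ℝ

/-- The cost of a clustering together with a choice of centers. -/
noncomputable def CostData.cost {n k : ℕ} (R : CostData n) (C : Fin n → Fin k)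
    (c : Fin k → Fin n) (d : Fin n → Fin n → ℝ) : ℝ :=
  match R.kind with
  | .total => ∑ i, (R.f (c i) + ∑ u with C u = i, R.g u (d u (c i)))
  | .bottleneck => max (⨆ i, R.f (c i)) (⨆ u, R.g u (d u (c (C u))))

/-- The cost of a clustering: the minimum over all choices of centers. -/
noncomputable def CostData.objective {n : ℕ} (R : CostData n) (k : ℕ) : Objective n k :=
  fun C d => ⨅ c : Centers C, R.cost C c.1 d

/-- `H` is the natural center-based objective given by the data `R`: it has the form prescribed
by `R`, and it is center-based, which means that for every metric there is an optimal clustering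
with optimal centers in which each point belongs to the cluster of a center nearest to it. -/
structure IsNaturalWith {n k : ℕ} (H : Objective n k) (R : CostData n) : Prop where
  eq_objective : ∀ C d, IsClustering C → IsMetric d → H C d = R.objective k C d
  voronoi : ∀ d, IsMetric d → ∃ C, IsOptimal H d C ∧ ∃ c : Centers C,
    R.cost C c.1 d = H C d ∧ ∀ u j, d u (c.1 (C u)) ≤ d u (c.1 j)

/-- `H` is a natural center-based objective. -/
def IsNaturalCenterBased {n k : ℕ} (H : Objective n k) : Prop :=
  ∃ R, IsNaturalWith H R

/-- The `k`-means objective. -/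
noncomputable def kMeans (n k : ℕ) : Objective n k :=
  fun C d => ⨅ c : Centers C, ∑ i, ∑ u with C u = i, d u (c.1 i) ^ 2

/-- The `k`-median objective. -/
noncomputable def kMedian (n k : ℕ) : Objective n k :=
  fun C d => ⨅ c : Centers C, ∑ i, ∑ u with C u = i, d u (c.1 i)

/-- The `k`-center objective. -/
noncomputable def kCenter (n k : ℕ) : Objective n k :=
  fun C d => ⨅ c : Centers C, ⨆ i, ⨆ u : {u // C u = i}, d u.1 (c.1 i)

/-- The metric facility location objective with opening costs `f`. -/
noncomputable def facilityLocation {n : ℕ} (f : Fin n → ℝ) (k : ℕ) : Objective n k :=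
  fun C d => ⨅ c : Centers C, (∑ i, f (c.1 i) + ∑ u, d u (c.1 (C u)))

/-! ## The machine model

Random access programs that work on natural numbers and on real numbers, with a step count.
Memory consists of natural and of real cells. A cell is addressed by the name of an array and
three indices. The operations are additions, subtractions and comparisons; there is no
multiplication, no rounding, and no way to turn a real number into a natural number. -/

/-- The read-only input. The entries are queried one at a time. -/
structure Input where
  size : ℕ
  clusters : ℕ
  kind : Kind
  dist : ℕ → ℕ → ℝ
  centerCost : ℕ → ℝ
  connCost : ℕ → ℕ → ℝ

/-- The input that presents an instance: the numbers `n` and `k`, the kind of the objective, and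
the values `d u v`, `f c` and `g u (d u c)` (queries outside of the range return zero). -/
noncomputable def instanceInput {n : ℕ} (k : ℕ) (R : CostData n) (d : Fin n → Fin n → ℝ) :
    Input where
  size := n
  clusters := k
  kind := R.kind
  dist u v := if h : u < n ∧ v < n then d ⟨u, h.1⟩ ⟨v, h.2⟩ else 0
  centerCost c := if h : c < n then R.f ⟨c, h⟩ else 0
  connCost u c := if h : u < n ∧ c < n then R.g ⟨u, h.1⟩ (d ⟨u, h.1⟩ ⟨c, h.2⟩) else 0

/-- The name of an array and three indices. -/
abbrev Cell : Type := ℕ × ℕ × ℕ × ℕ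

/-- The contents of the memory. -/
structure Store where
  nat : Cell → ℕ
  real : Cell → ℝ

/-- The initial memory, in which all cells are zero. -/
def Store.init : Store where
  nat _ := 0
  real _ := 0

/-- Expressions for natural numbers. -/
inductive NExp
  | lit (m : ℕ)
  | size
  | clusters
  | kind
  | get (a : ℕ) (i j l : NExp)
  | add (x y : NExp)
  | sub (x y : NExp)

/-- Expressions for real numbers. -/
inductive RExp
  | zero
  | dist (u v : NExp)
  | centerCost (c : NExp)
  | connCost (u c : NExp)
  | get (a : ℕ) (i j l : NExp)
  | add (x y : RExp)
  | sub (x y : RExp)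

/-- Tests. -/
inductive BExp
  | natLt (x y : NExp)
  | realLt (x y : RExp)
  | neg (b : BExp)
  | conj (b b' : BExp)

/-- Programs. -/
inductive Prog
  | skip
  | setNat (a : ℕ) (i j l e : NExp)
  | setReal (a : ℕ) (i j l : NExp) (e : RExp)
  | seq (p q : Prog)
  | branch (b : BExp) (p q : Prog)
  | loop (b : BExp) (p : Prog)

/-- The value of an expression. Subtraction of natural numbers is truncated at zero. -/
def NExp.eval (I : Input) (s : Store) : NExp → ℕ
  | .lit m => m
  | .size => I.size
  | .clusters => I.clusters
  | .kind => match I.kind with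
    | .total => 0
    | .bottleneck => 1
  | .get a i j l => s.nat (a, i.eval I s, j.eval I s, l.eval I s)
  | .add x y => x.eval I s + y.eval I s
  | .sub x y => x.eval I s - y.eval I s

/-- The value of an expression. -/
noncomputable def RExp.eval (I : Input) (s : Store) : RExp → ℝ
  | .zero => 0
  | .dist u v => I.dist (u.eval I s) (v.eval I s)
  | .centerCost c => I.centerCost (c.eval I s)
  | .connCost u c => I.connCost (u.eval I s) (c.eval I s)
  | .get a i j l => s.real (a, i.eval I s, j.eval I s, l.eval I s)
  | .add x y => x.eval I s + y.eval I s
  | .sub x y => x.eval I s - y.eval I s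

/-- The truth value of a test. -/
def BExp.Holds (I : Input) (s : Store) : BExp → Prop
  | .natLt x y => x.eval I s < y.eval I s
  | .realLt x y => x.eval I s < y.eval I s
  | .neg b => ¬ b.Holds I s
  | .conj b b' => b.Holds I s ∧ b'.Holds I s

/-- The number of steps that the evaluation takes: one for every operation. -/
def NExp.steps : NExp → ℕ
  | .lit _ | .size | .clusters | .kind => 1
  | .get _ i j l => i.steps + j.steps + l.steps + 1
  | .add x y | .sub x y => x.steps + y.steps + 1

/-- The number of steps that the evaluation takes: one for every operation. -/
def RExp.steps : RExp → ℕ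
  | .zero => 1
  | .centerCost c => c.steps + 1
  | .dist u v | .connCost u v => u.steps + v.steps + 1
  | .get _ i j l => i.steps + j.steps + l.steps + 1
  | .add x y | .sub x y => x.steps + y.steps + 1

/-- The number of steps that the evaluation takes: one for every operation. -/
def BExp.steps : BExp → ℕ
  | .natLt x y => x.steps + y.steps + 1
  | .realLt x y => x.steps + y.steps + 1
  | .neg b => b.steps + 1
  | .conj b b' => b.steps + b'.steps + 1

/-- `Runs I p s s' t`: on input `I`, the program `p`, started with memory `s`, halts after `t`
steps with memory `s'`. -/
inductive Runs (I : Input) : Prog → Store → Store → ℕ → Prop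
  | skip (s : Store) : Runs I .skip s s 1
  | setNat (s : Store) (a : ℕ) (i j l e : NExp) :
      Runs I (.setNat a i j l e) s
        { s with nat := Function.update s.nat (a, i.eval I s, j.eval I s, l.eval I s) (e.eval I s) }
        (i.steps + j.steps + l.steps + e.steps + 1)
  | setReal (s : Store) (a : ℕ) (i j l : NExp) (e : RExp) :
      Runs I (.setReal a i j l e) s
        { s with
          real := Function.update s.real (a, i.eval I s, j.eval I s, l.eval I s) (e.eval I s) }
        (i.steps + j.steps + l.steps + e.steps + 1)
  | seq {p q : Prog} {s s' s'' : Store} {t t' : ℕ} :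
      Runs I p s s' t → Runs I q s' s'' t' → Runs I (.seq p q) s s'' (t + t')
  | branch_pos {b : BExp} {p q : Prog} {s s' : Store} {t : ℕ} :
      b.Holds I s → Runs I p s s' t → Runs I (.branch b p q) s s' (b.steps + t + 1)
  | branch_neg {b : BExp} {p q : Prog} {s s' : Store} {t : ℕ} :
      ¬ b.Holds I s → Runs I q s s' t → Runs I (.branch b p q) s s' (b.steps + t + 1)
  | loop_halt {b : BExp} {p : Prog} {s : Store} :
      ¬ b.Holds I s → Runs I (.loop b p) s s (b.steps + 1)
  | loop_next {b : BExp} {p : Prog} {s s' s'' : Store} {t t' : ℕ} :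
      b.Holds I s → Runs I p s s' t → Runs I (.loop b p) s' s'' t' →
      Runs I (.loop b p) s s'' (b.steps + t + t' + 1)

/-- Programs are deterministic: the final memory and the number of steps are unique. -/
theorem Runs.deterministic {I : Input} {p : Prog} {s s₁ s₂ : Store} {t₁ t₂ : ℕ}
    (h₁ : Runs I p s s₁ t₁) (h₂ : Runs I p s s₂ t₂) : s₁ = s₂ ∧ t₁ = t₂ := by
  induction h₁ generalizing s₂ t₂ with
  | skip | setNat | setReal => cases h₂; exact ⟨rfl, rfl⟩
  | seq _ _ ih ih' =>
    cases h₂ with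
    | seq a b =>
      obtain ⟨rfl, rfl⟩ := ih a
      obtain ⟨rfl, rfl⟩ := ih' b
      exact ⟨rfl, rfl⟩
  | branch_pos hb _ ih =>
    cases h₂ with
    | branch_pos _ a => obtain ⟨rfl, rfl⟩ := ih a; exact ⟨rfl, rfl⟩
    | branch_neg hb' _ => exact absurd hb hb'
  | branch_neg hb _ ih =>
    cases h₂ with
    | branch_neg _ a => obtain ⟨rfl, rfl⟩ := ih a; exact ⟨rfl, rfl⟩
    | branch_pos hb' _ => exact absurd hb' hb
  | loop_halt hb =>
    cases h₂ with
    | loop_halt _ => exact ⟨rfl, rfl⟩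
    | loop_next hb' _ _ => exact absurd hb' hb
  | loop_next hb _ _ ih ih' =>
    cases h₂ with
    | loop_halt hb' => exact absurd hb hb'
    | loop_next _ a b =>
      obtain ⟨rfl, rfl⟩ := ih a
      obtain ⟨rfl, rfl⟩ := ih' b
      exact ⟨rfl, rfl⟩

/-- The memory `s` holds the labeling `C` as output: the label of the point `u` is stored in the
natural array `0` at the indices `(u, 0, 0)`. -/
def Outputs {n k : ℕ} (s : Store) (C : Fin n → Fin k) : Prop :=
  ∀ u : Fin n, s.nat (0, u, 0, 0) = C u

end Clustering

open Clustering

/-!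
Let `m` send each point to its center in an optimal clustering of a 2-metric perturbation resilient
instance. If a point `p` were at distance at most `2 * d p (m p)` from a foreign center `q`, then
adding an edge of length `2 * d p (m p)` between `p` and `q` to the metric `2 * d` would give a
perturbation that keeps the distances inside the clusters and in which `p` can move to `q` at no
cost, contrary to uniqueness. Applying this to both ends of a pair shows that every point is closer
to its own center than to any point of another cluster. By the cut property of minimum spanning
trees, each cluster is then connected in the tree built by Prim's algorithm.

So the optimal clustering is the partition of this tree into `k` subtrees, each labeled by one of
its points, of minimal cost. It is found by dynamic programming in the reverse of Prim's order. A
state consists of the position `t` of a vertex, the label of its parent and the number of centers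
that are available for the subtrees of `t` and of its later siblings. That the subtrees are labeled
consistently can be tested locally: a vertex either has the label of its parent, or its label lies
in its own subtree while that of its parent does not.
-/

namespace Clustering

/-! ## Center maps -/

section CenterMaps

variable {n k : ℕ}

/-- Combination of costs: the sum or the maximum, depending on the kind of the objective. -/
noncomputable def Kind.op (κ : Kind) (x y : ℝ) : ℝ :=
  match κ with
  | .total => x + y
  | .bottleneck => max x y

instance (κ : Kind) : Std.Commutative κ.op :=
  ⟨fun x y => by cases κ <;> simp only [Kind.op, add_comm, max_comm]⟩

instance (κ : Kind) : Std.Associative κ.op :=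
  ⟨fun x y z => by cases κ <;> simp only [Kind.op, add_assoc, max_assoc]⟩

theorem Kind.op_mono (κ : Kind) ⦃a b c d : ℝ⦄ (h : a ≤ b) (h' : c ≤ d) : κ.op a c ≤ κ.op b d := by
  cases κ
  · exact add_le_add h h'
  · exact max_le_max h h'

/-- The contribution of the point `u` to the cost if its center is `c`; a center also contributes
its opening cost. -/
noncomputable def CostData.own (R : CostData n) (d : Fin n → Fin n → ℝ) (u c : Fin n) : ℝ :=
  if c = u then R.kind.op (R.g u (d u c)) (R.f u) else R.g u (d u c)

/-- The cost of the clustering with centers that is encoded by the map `m`, which sends each point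
to the center of its cluster. -/
noncomputable def CostData.mapCost (R : CostData n) (m : Fin n → Fin n)
    (d : Fin n → Fin n → ℝ) : ℝ :=
  match R.kind with
  | .total => ∑ u, R.own d u (m u)
  | .bottleneck => ⨆ u, R.own d u (m u)

/-- `m` encodes a clustering into `k` clusters with centers: it sends each point to the center of
its cluster. -/
structure IsCenterMap (k : ℕ) (m : Fin n → Fin n) : Prop where
  idem : ∀ u, m (m u) = m u
  card : (Finset.univ.filter fun u => m u = u).card = k

/-- `m` is a cheapest center map. -/
def IsOptimalMap (R : CostData n) (k : ℕ) (d : Fin n → Fin n → ℝ) (m : Fin n → Fin n) : Prop :=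
  IsCenterMap k m ∧ ∀ m', IsCenterMap k m' → R.mapCost m d ≤ R.mapCost m' d

theorem filter_center_eq_image {C : Fin n → Fin k} {c : Fin k → Fin n} (hc : ∀ i, C (c i) = i) :
    (Finset.univ.filter fun u => c (C u) = u) = Finset.univ.image c := by
  ext u
  simp only [Finset.mem_filter, Finset.mem_univ, true_and, Finset.mem_image]
  refine ⟨fun h => ⟨_, h⟩, ?_⟩
  rintro ⟨i, rfl⟩
  rw [hc]

theorem isCenterMap_comp {C : Fin n → Fin k} {c : Fin k → Fin n} (hc : ∀ i, C (c i) = i) :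
    IsCenterMap k fun u => c (C u) where
  idem u := by simp only [hc]
  card := by
    rw [filter_center_eq_image hc, Finset.card_image_of_injective _
      (Function.LeftInverse.injective hc), Finset.card_univ, Fintype.card_fin]

theorem exists_isCenterMap (hk : 0 < k) (hkn : k ≤ n) : ∃ m : Fin n → Fin n, IsCenterMap k m := by
  have : Nonempty (Fin k) := ⟨⟨0, hk⟩⟩
  exact ⟨_, isCenterMap_comp
    (Function.leftInverse_invFun (Fin.castLE_injective hkn))⟩

section Cost

variable {R : CostData n} {d d' : Fin n → Fin n → ℝ}

theorem own_of_total (h : R.kind = .total) (u c : Fin n) :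
    R.own d u c = R.g u (d u c) + if c = u then R.f u else 0 := by
  unfold CostData.own Kind.op
  split_ifs <;> simp [h]

theorem own_le_iff_of_bottleneck (h : R.kind = .bottleneck) {u c : Fin n} {x : ℝ} :
    R.own d u c ≤ x ↔ R.g u (d u c) ≤ x ∧ (c = u → R.f u ≤ x) := by
  unfold CostData.own Kind.op
  split_ifs with hc <;> simp [h, hc]

theorem own_congr {u c : Fin n} (h : d u c = d' u c) : R.own d u c = R.own d' u c := by
  unfold CostData.own
  rw [h]

theorem mapCost_mono {m m' : Fin n → Fin n} (h : ∀ u, R.own d u (m u) ≤ R.own d' u (m' u)) :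
    R.mapCost m d ≤ R.mapCost m' d' := by
  unfold CostData.mapCost
  cases R.kind
  · exact Finset.sum_le_sum fun u _ => h u
  · exact ciSup_mono (Set.finite_range _).bddAbove h

theorem mapCost_congr {m m' : Fin n → Fin n} (h : ∀ u, R.own d u (m u) = R.own d' u (m' u)) :
    R.mapCost m d = R.mapCost m' d' :=
  le_antisymm (mapCost_mono fun u => (h u).le) (mapCost_mono fun u => (h u).ge)

theorem sum_sum_fiber {β : Type*} [AddCommMonoid β] (C : Fin n → Fin k) (F : Fin n → Fin k → β) :
    ∑ i, ∑ u with C u = i, F u i = ∑ u, F u (C u) := by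
  rw [← Finset.sum_fiberwise Finset.univ C]
  refine Finset.sum_congr rfl fun i _ => Finset.sum_congr rfl fun u hu => ?_
  rw [(Finset.mem_filter.1 hu).2]

theorem ciSup_le_iff_of_finite {ι : Type*} [Finite ι] [Nonempty ι] {F : ι → ℝ} {x : ℝ} :
    ⨆ i, F i ≤ x ↔ ∀ i, F i ≤ x :=
  ciSup_le_iff (Set.finite_range F).bddAbove

theorem cost_eq_mapCost (hk : 0 < k) {C : Fin n → Fin k} {c : Fin k → Fin n}
    (hc : ∀ i, C (c i) = i) : R.cost C c d = R.mapCost (fun u => c (C u)) d := by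
  have : Nonempty (Fin k) := ⟨⟨0, hk⟩⟩
  have : Nonempty (Fin n) := ⟨c ⟨0, hk⟩⟩
  unfold CostData.cost CostData.mapCost
  cases h : R.kind
  · simp only [own_of_total h, Finset.sum_add_distrib]
    rw [sum_sum_fiber C fun u i => R.g u (d u (c i)), ← Finset.sum_filter,
      filter_center_eq_image hc,
      Finset.sum_image (Function.LeftInverse.injective hc).injOn, add_comm]
  · refine eq_of_forall_ge_iff fun x => ?_
    simp only [max_le_iff, ciSup_le_iff_of_finite, own_le_iff_of_bottleneck h]
    constructor
    · rintro ⟨hf, hg⟩ u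
      exact ⟨hg u, fun hu => hu ▸ hf (C u)⟩
    · intro hown
      exact ⟨fun i => (hown (c i)).2 (by rw [hc]), fun u => (hown u).1⟩

end Cost

theorem exists_centers {C : Fin n → Fin k} {m : Fin n → Fin n} (hC : IsClustering C)
    (hm : ∀ u, m (m u) = m u) (hker : ∀ u v, C u = C v ↔ m u = m v) :
    ∃ c : Centers C, ∀ u, c.1 (C u) = m u := by
  choose r hr using hC
  exact ⟨⟨fun i => m (r i), fun i => ((hker _ _).2 (hm _)).trans (hr i)⟩,
    fun u => (hker _ _).1 (hr _)⟩

theorem IsCenterMap.exists_clustering {m : Fin n → Fin n} (hm : IsCenterMap k m) :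
    ∃ C : Fin n → Fin k, IsClustering C ∧ ∀ u v, C u = C v ↔ m u = m v := by
  have hcard : Fintype.card {u // m u = u} = k := by
    rw [Fintype.card_subtype]
    exact hm.card
  let e := Fintype.equivFinOfCardEq hcard
  refine ⟨fun u => e ⟨m u, hm.idem u⟩, fun i => ⟨(e.symm i).1, ?_⟩, fun u v => by simp⟩
  have : (⟨m (e.symm i).1, hm.idem _⟩ : {u // m u = u}) = e.symm i := Subtype.ext (e.symm i).2
  simp only [this, Equiv.apply_symm_apply]

section Objective

variable {H : Objective n k} {R : CostData n} {d : Fin n → Fin n → ℝ} {C : Fin n → Fin k}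

theorem objective_le_mapCost (hk : 0 < k) {m : Fin n → Fin n} (hC : IsClustering C)
    (hm : ∀ u, m (m u) = m u) (hker : ∀ u v, C u = C v ↔ m u = m v) :
    R.objective k C d ≤ R.mapCost m d := by
  obtain ⟨c, hc⟩ := exists_centers hC hm hker
  calc R.objective k C d ≤ R.cost C c.1 d := ciInf_le (Set.finite_range _).bddBelow c
    _ = R.mapCost m d := by rw [cost_eq_mapCost hk c.2, funext hc]

theorem exists_objective_eq_mapCost (hk : 0 < k) (hC : IsClustering C) :
    ∃ m, IsCenterMap k m ∧ R.objective k C d = R.mapCost m d := by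
  have : Nonempty (Centers C) := by
    choose r hr using hC
    exact ⟨⟨r, hr⟩⟩
  obtain ⟨c, hc⟩ := exists_eq_ciInf_of_finite (f := fun c : Centers C => R.cost C c.1 d)
  refine ⟨_, isCenterMap_comp c.2, ?_⟩
  rw [← cost_eq_mapCost hk c.2, hc]
  rfl

theorem IsOptimalMap.isOptimal (hk : 0 < k)
    (heq : ∀ C, IsClustering C → H C d = R.objective k C d) {m : Fin n → Fin n}
    (hm : IsOptimalMap R k d m) (hC : IsClustering C) (hker : ∀ u v, C u = C v ↔ m u = m v) :
    IsOptimal H d C := by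
  refine ⟨hC, fun C' hC' => ?_⟩
  obtain ⟨m', hm', h'⟩ := exists_objective_eq_mapCost (R := R) (d := d) hk hC'
  rw [heq C hC, heq C' hC', h']
  exact (objective_le_mapCost hk hC hm.1.idem hker).trans (hm.2 m' hm')

theorem IsNaturalWith.exists_voronoi (hk : 0 < k) (hH : IsNaturalWith H R) (hd : IsMetric d) :
    ∃ m, IsOptimalMap R k d m ∧ ∀ u v, d u (m u) ≤ d u (m v) := by
  obtain ⟨C, hC, c, hc, hv⟩ := hH.voronoi d hd
  refine ⟨_, ⟨isCenterMap_comp c.2, fun m' hm' => ?_⟩, fun u v => hv u _⟩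
  obtain ⟨C', hC', hker⟩ := hm'.exists_clustering
  calc R.mapCost _ d = H C d := by rw [← cost_eq_mapCost hk c.2, hc]
    _ ≤ H C' d := hC.2 C' hC'
    _ = R.objective k C' d := hH.eq_objective C' d hC' hd
    _ ≤ R.mapCost m' d := objective_le_mapCost hk hC' hm'.idem hker

end Objective

end CenterMaps

/-! ## Monotone connection costs -/

section Metric

variable {n : ℕ} {d : Fin n → Fin n → ℝ}

theorem IsMetric.self (hd : IsMetric d) (u : Fin n) : d u u = 0 := (hd.eq_zero_iff u u).2 rfl

theorem IsMetric.nonneg (hd : IsMetric d) (u v : Fin n) : 0 ≤ d u v := by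
  linarith [hd.triangle u v u, hd.self u, hd.symm v u]

theorem IsMetric.pos (hd : IsMetric d) {u v : Fin n} (huv : u ≠ v) : 0 < d u v :=
  (hd.nonneg u v).lt_of_ne fun h => huv ((hd.eq_zero_iff u v).1 h.symm)

end Metric

section Monotone

variable {n k : ℕ} {R : CostData n} {d : Fin n → Fin n → ℝ}

theorem IsMetric.exists_nearest_center (hd : IsMetric d) {m : Fin n → Fin n}
    (hm : ∀ u, m (m u) = m u) :
    ∃ q : Fin n → Fin n, (∀ u, m (q u) = q u) ∧ (∀ u v, d u (q u) ≤ d u (m v)) ∧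
      ∀ u, q u = u ↔ m u = u := by
  have hnear : ∀ u, ∃ c, m c = c ∧ ∀ v, d u c ≤ d u (m v) := fun u => by
    obtain ⟨c, hc, hmin⟩ := Set.exists_min_image {c | m c = c} (d u) (Set.toFinite _) ⟨m u, hm u⟩
    exact ⟨c, hc, fun v => hmin _ (hm v)⟩
  choose q hq hmin using hnear
  refine ⟨q, hq, hmin, fun u => ⟨fun h => h ▸ hq u, fun h => ?_⟩⟩
  have h0 : d u (q u) ≤ 0 := by simpa only [h, hd.self] using hmin u u
  exact ((hd.eq_zero_iff _ _).1 (h0.antisymm (hd.nonneg _ _))).symm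

theorem exists_voronoi_of_monotone (hk : 0 < k) (hkn : k ≤ n)
    (hg : ∀ u, MonotoneOn (R.g u) (Set.Ici 0)) (hd : IsMetric d) :
    ∃ m, IsOptimalMap R k d m ∧ ∀ u v, d u (m u) ≤ d u (m v) := by
  obtain ⟨m, hm, hmin⟩ := Set.exists_min_image {m : Fin n → Fin n | IsCenterMap k m}
    (fun m => R.mapCost m d) (Set.toFinite _) (exists_isCenterMap hk hkn)
  obtain ⟨q, hq, hnear, hfix⟩ := hd.exists_nearest_center hm.idem
  have hqm : IsCenterMap k q :=
    ⟨fun u => (hfix _).2 (hq u), by simp only [hfix]; exact hm.card⟩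
  have hle : R.mapCost q d ≤ R.mapCost m d := mapCost_mono fun u => by
    unfold CostData.own
    by_cases h : m u = u
    · rw [(hfix u).2 h, h]
    · rw [if_neg h, if_neg (mt (hfix u).1 h)]
      exact hg u (hd.nonneg _ _) (hd.nonneg _ _) (hnear u u)
  exact ⟨q, ⟨hqm, fun m' hm' => hle.trans (hmin m' hm')⟩, fun u v => hq v ▸ hnear u (q v)⟩

theorem isNaturalWith_of_monotone (hk : 0 < k) (hkn : k ≤ n) {H : Objective n k}
    (hg : ∀ u, MonotoneOn (R.g u) (Set.Ici 0))
    (heq : ∀ C d, IsClustering C → IsMetric d → H C d = R.objective k C d) :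
    IsNaturalWith H R where
  eq_objective := heq
  voronoi d hd := by
    obtain ⟨m, hm, hv⟩ := exists_voronoi_of_monotone hk hkn hg hd
    obtain ⟨C, hC, hker⟩ := hm.1.exists_clustering
    obtain ⟨c, hc⟩ := exists_centers hC hm.1.idem hker
    obtain ⟨m', hm', h'⟩ := exists_objective_eq_mapCost (R := R) (d := d) hk hC
    have hcost : R.cost C c.1 d = R.mapCost m d := by rw [cost_eq_mapCost hk c.2, funext hc]
    refine ⟨C, hm.isOptimal hk (fun C hC => heq C d hC hd) hC hker, c, ?_, fun u j => ?_⟩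
    · rw [heq C d hC hd]
      refine le_antisymm ?_ (ciInf_le (Set.finite_range _).bddBelow c)
      rw [hcost, h']
      exact hm.2 m' hm'
    · obtain ⟨v, rfl⟩ := hC j
      rw [hc, hc]
      exact hv u v

theorem isNaturalCenterBased_kMeans (hk : 0 < k) (hkn : k ≤ n) :
    IsNaturalCenterBased (kMeans n k) :=
  ⟨⟨.total, fun _ => 0, fun _ r => r ^ 2⟩, isNaturalWith_of_monotone hk hkn
    (fun _ _ hx _ _ hxy => pow_le_pow_left₀ hx hxy 2)
    fun _ _ _ _ => by simp [kMeans, CostData.objective, CostData.cost]⟩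

theorem isNaturalCenterBased_kMedian (hk : 0 < k) (hkn : k ≤ n) :
    IsNaturalCenterBased (kMedian n k) :=
  ⟨⟨.total, fun _ => 0, fun _ r => r⟩, isNaturalWith_of_monotone hk hkn
    (fun _ => monotone_id.monotoneOn _)
    fun _ _ _ _ => by simp [kMedian, CostData.objective, CostData.cost]⟩

theorem ciSup_ciSup_fiber_le_iff {C : Fin n → Fin k} (hC : IsClustering C)
    {F : Fin n → Fin k → ℝ} (hk : 0 < k) {x : ℝ} :
    ⨆ i, ⨆ u : {u // C u = i}, F u i ≤ x ↔ ∀ u, F u (C u) ≤ x := by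
  have : Nonempty (Fin k) := ⟨⟨0, hk⟩⟩
  have : ∀ i, Nonempty {u // C u = i} := fun i => (hC i).elim fun u hu => ⟨⟨u, hu⟩⟩
  simp only [ciSup_le_iff_of_finite, Subtype.forall, forall_comm (α := Fin k), forall_eq']

theorem isNaturalCenterBased_kCenter (hk : 0 < k) (hkn : k ≤ n) :
    IsNaturalCenterBased (kCenter n k) := by
  refine ⟨⟨.bottleneck, fun _ => 0, fun _ r => r⟩, isNaturalWith_of_monotone hk hkn
    (fun _ => monotone_id.monotoneOn _) fun C d hC hd => ?_⟩
  have : Nonempty (Fin k) := ⟨⟨0, hk⟩⟩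
  have : Nonempty (Fin n) := ⟨⟨0, hk.trans_le hkn⟩⟩
  refine congrArg iInf (funext fun c => eq_of_forall_ge_iff fun x => ?_)
  simp only [CostData.cost]
  rw [ciSup_ciSup_fiber_le_iff hC hk (F := fun u i => d u (c.1 i)), max_le_iff,
    ciSup_le_iff_of_finite, ciSup_le_iff_of_finite]
  exact ⟨fun h => ⟨fun i => (hd.nonneg _ _).trans (h (c.1 i)), h⟩, And.right⟩

theorem isNaturalCenterBased_facilityLocation (hk : 0 < k) (hkn : k ≤ n) (f : Fin n → ℝ) :
    IsNaturalCenterBased (facilityLocation f k) := by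
  refine ⟨⟨.total, f, fun _ r => r⟩, isNaturalWith_of_monotone hk hkn
    (fun _ => monotone_id.monotoneOn _) fun C d _ _ => congrArg iInf (funext fun c => ?_)⟩
  simp only [CostData.cost, Finset.sum_add_distrib, sum_sum_fiber C fun u i => d u (c.1 i)]

end Monotone

/-! ## Separation of the clusters of a resilient instance -/

section Separation

variable {n k : ℕ} {d ρ : Fin n → Fin n → ℝ}

/-- The distances obtained from `ρ` by adding an edge of length `ℓ` between `p` and `q`. -/
noncomputable def shortcut (ρ : Fin n → Fin n → ℝ) (ℓ : ℝ) (p q u v : Fin n) : ℝ :=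
  min (ρ u v) (min (ρ u p + ℓ + ρ q v) (ρ u q + ℓ + ρ p v))

theorem shortcut_triangle (hρ : IsMetric ρ) {ℓ : ℝ} (hℓ : 0 < ℓ) (p q u v w : Fin n) :
    shortcut ρ ℓ p q u w ≤ shortcut ρ ℓ p q u v + shortcut ρ ℓ p q v w := by
  have nonneg := hρ.nonneg
  have triangle := hρ.triangle
  simp only [shortcut, min_add, add_min, le_min_iff, min_le_iff]
  refine ⟨⟨.inl (triangle u v w), .inr (.inl ?_), .inr (.inr ?_)⟩,
    ⟨.inr (.inl ?_), .inr (.inl ?_), .inl ?_⟩, .inr (.inr ?_), .inl ?_, .inr (.inr ?_)⟩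
  · linarith [triangle q v w]
  · linarith [triangle p v w]
  · linarith [triangle u v p]
  · linarith [nonneg q v, nonneg v p]
  · linarith [triangle u q w, nonneg p v, nonneg v p]
  · linarith [triangle u v q]
  · linarith [triangle u p w, nonneg q v, nonneg v q]
  · linarith [nonneg p v, nonneg v q]

theorem isMetric_shortcut (hρ : IsMetric ρ) {ℓ : ℝ} (hℓ : 0 < ℓ) (p q : Fin n) :
    IsMetric (shortcut ρ ℓ p q) where
  eq_zero_iff u v := by
    have nonneg := hρ.nonneg
    constructor
    · intro h
      by_contra huv
      have : 0 < shortcut ρ ℓ p q u v := lt_min (hρ.pos huv)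
        (lt_min (by linarith [nonneg u p, nonneg q v]) (by linarith [nonneg u q, nonneg p v]))
      exact this.ne' h
    · rintro rfl
      rw [shortcut, hρ.self, min_eq_left]
      exact le_min (by linarith [nonneg u p, nonneg q u]) (by linarith [nonneg u q, nonneg p u])
  symm u v := by
    rw [shortcut, shortcut, hρ.symm u v, hρ.symm u p, hρ.symm u q, hρ.symm v p, hρ.symm v q,
      min_comm (_ + _)]
    congr 2 <;> ring
  triangle := shortcut_triangle hρ hℓ p q

theorem shortcut_self_apply (hρ : IsMetric ρ) {ℓ : ℝ} {p q : Fin n} (h : ℓ ≤ ρ p q) :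
    shortcut ρ ℓ p q p q = ℓ := by
  have := hρ.nonneg p q
  rw [shortcut, hρ.self, hρ.self, zero_add, add_zero,
    min_eq_left (show ℓ ≤ ρ p q + ℓ + ρ p q by linarith), min_eq_right h]

theorem IsMetric.const_mul (hd : IsMetric d) {α : ℝ} (hα : 0 < α) :
    IsMetric fun u v => α * d u v where
  eq_zero_iff u v := by simp [hα.ne', hd.eq_zero_iff]
  symm u v := by rw [hd.symm]
  triangle u v w := by
    rw [← mul_add]
    exact mul_le_mul_of_nonneg_left (hd.triangle u v w) hα.le

theorem isMetricPerturbation_const_mul (hd : IsMetric d) {α : ℝ} (hα : 1 ≤ α) :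
    IsMetricPerturbation α d fun u v => α * d u v :=
  ⟨hd.const_mul (by linarith), fun u v => ⟨le_mul_of_one_le_left (hd.nonneg u v) hα, le_rfl⟩⟩

/-- Resilience of a natural center-based objective in terms of center maps: `C` is the clustering
of every optimal center map for every perturbation of `d`. -/
structure IsMapResilient (α : ℝ) (R : CostData n) (d : Fin n → Fin n → ℝ) (C : Fin n → Fin k) :
    Prop where
  metric : IsMetric d
  ker : ∀ d', IsMetricPerturbation α d d' → ∀ m, IsOptimalMap R k d' m →
    ∀ u v, C u = C v ↔ m u = m v
  voronoi : ∀ d', IsMetric d' → ∃ m, IsOptimalMap R k d' m ∧ ∀ u v, d' u (m u) ≤ d' u (m v)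

variable {α : ℝ} {R : CostData n} {C : Fin n → Fin k} {m : Fin n → Fin n} {p q : Fin n}

theorem exists_isMapResilient {H : Objective n k} (hk : 0 < k) (hd : IsMetric d)
    (hH : IsNaturalWith H R) (hres : IsMetricPerturbationResilient α H d) :
    ∃ C : Fin n → Fin k, IsMapResilient α R d C := by
  obtain ⟨C, -, hu⟩ := hres
  refine ⟨C, hd, fun d' hd' m hm u v => ?_, fun d' hd' => hH.exists_voronoi hk hd'⟩
  obtain ⟨C', hC', hker⟩ := hm.1.exists_clustering
  have hopt := hm.isOptimal hk (fun C hC => hH.eq_objective C d' hC hd'.1) hC' hker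
  rw [(hu d' hd').2 C' hopt u v, hker]

theorem isMetricPerturbation_shortcut (hd : IsMetric d) (hα : 1 ≤ α) {r : ℝ} (hr : 0 < r)
    (hpq : d p q ≤ α * r) :
    IsMetricPerturbation α d (shortcut (fun u v => α * d u v) (α * r) p q) := by
  have hα0 : 0 < α := by linarith
  have hle : ∀ u v, d u v ≤ α * d u v := fun u v => le_mul_of_one_le_left (hd.nonneg u v) hα
  refine ⟨isMetric_shortcut (hd.const_mul hα0) (mul_pos hα0 hr) p q,
    fun u v => ⟨le_min (hle u v) (le_min ?_ ?_), min_le_left _ _⟩⟩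
  · linarith [hle u p, hle q v, hd.triangle u p v, hd.triangle p q v]
  · linarith [hle u q, hle p v, hd.triangle u q v, hd.triangle q p v, hd.symm p q]

/-- A path through the new edge is no shorter, since `p` is as far from `m p` as the length of the
edge, and all points are closer to their own centers than to `m p` and `q`. -/
theorem shortcut_eq_of_same_center (hd : IsMetric d) (hα : 0 ≤ α) (hm : ∀ u, m (m u) = m u)
    (hv : ∀ u v, d u (m u) ≤ d u (m v)) (hq : m q = q) {u v : Fin n} (huv : m u = m v) :
    shortcut (fun u v => α * d u v) (α * d p (m p)) p q u v = α * d u v := by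
  have hnear : ∀ a b, m b = b → d a (m a) ≤ d a b := fun a b hb => by
    simpa only [hb] using hv a b
  refine min_eq_left (le_min ?_ ?_) <;> rw [← mul_add, ← mul_add] <;>
    refine mul_le_mul_of_nonneg_left ?_ hα
  · have hvq := hnear v q hq
    rw [← huv] at hvq
    linarith [hnear u (m p) (hm p), hd.triangle u p (m p), hd.triangle u (m u) v,
      hd.symm v (m u), hd.symm v q]
  · have hvp := hnear v (m p) (hm p)
    rw [← huv] at hvp
    linarith [hnear u q hq, hd.triangle v p (m p), hd.triangle u (m u) v, hd.symm v (m u),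
      hd.symm v p]

theorem IsMapResilient.isOptimalMap_of_same_center {d' : Fin n → Fin n → ℝ}
    (h : IsMapResilient α R d C) (hρ : IsMetricPerturbation α d ρ)
    (hd' : IsMetricPerturbation α d d') (hm : IsOptimalMap R k ρ m)
    (heq : ∀ u v, m u = m v → d' u v = ρ u v) : IsOptimalMap R k d' m := by
  obtain ⟨m', hm', -⟩ := h.voronoi d' hd'.1
  have hker : ∀ u v, m u = m v ↔ m' u = m' v := fun u v => by
    rw [← h.ker ρ hρ m hm, h.ker d' hd' m' hm']
  refine ⟨hm.1, fun m'' hm'' => ?_⟩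
  calc R.mapCost m d' = R.mapCost m ρ :=
        mapCost_congr fun u => own_congr (heq u _ (hm.1.idem u).symm)
    _ ≤ R.mapCost m' ρ := hm.2 m' hm'.1
    _ = R.mapCost m' d' :=
        mapCost_congr fun u => own_congr (heq u _ ((hker _ _).2 (hm'.1.idem u).symm)).symm
    _ ≤ R.mapCost m'' d' := hm'.2 m'' hm''

theorem IsOptimalMap.update (hm : IsOptimalMap R k d m) (hp : m p ≠ p) (hpq : p ≠ q)
    (hq : m q = q) (hd : d p q = d p (m p)) : IsOptimalMap R k d (Function.update m p q) := by
  have hfix : ∀ u, Function.update m p q u = u ↔ m u = u := fun u => by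
    rcases eq_or_ne u p with rfl | hu
    · simp [hp, hpq.symm]
    · rw [Function.update_of_ne hu]
  have hcost : R.mapCost (Function.update m p q) d = R.mapCost m d := mapCost_congr fun u => by
    rcases eq_or_ne u p with rfl | hu
    · rw [Function.update_self, CostData.own, CostData.own, if_neg hpq.symm, if_neg hp, hd]
    · rw [Function.update_of_ne hu]
  refine ⟨⟨fun u => (hfix _).2 ?_, by simp only [hfix]; exact hm.1.card⟩,
    fun m' hm' => hcost.trans_le (hm.2 m' hm')⟩
  rcases eq_or_ne u p with rfl | hu
  · simpa using hq
  · rw [Function.update_of_ne hu]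
    exact hm.1.idem u

/-- Otherwise an edge of length `α * d p (m p)` between `p` and `q` allows to move `p` to the
cluster of `q` at no cost. -/
theorem IsMapResilient.proximity (h : IsMapResilient α R d C) (hα : 1 ≤ α)
    (hm : IsOptimalMap R k (fun u v => α * d u v) m) (hv : ∀ u v, d u (m u) ≤ d u (m v))
    (hq : m q = q) (hpq : m p ≠ q) : α * d p (m p) < d p q := by
  by_contra! hcon
  have hd := h.metric
  have hne : p ≠ q := by rintro rfl; exact hpq hq
  have hr : 0 < d p (m p) := pos_of_mul_pos_right ((hd.pos hne).trans_le hcon) (by linarith)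
  have hmp : m p ≠ p := fun h' => hr.ne' (by rw [h', hd.self])
  have hρ := isMetricPerturbation_const_mul hd hα
  have hpert := isMetricPerturbation_shortcut hd hα hr hcon
  have hin : ∀ u v, m u = m v → shortcut (fun u v => α * d u v) (α * d p (m p)) p q u v =
      α * d u v := fun u v => shortcut_eq_of_same_center hd (by linarith) hm.1.idem hv hq
  have hlen : α * d p (m p) ≤ α * d p q := by
    rw [← hq]
    exact mul_le_mul_of_nonneg_left (hv p q) (by linarith)
  have hmoved := (h.isOptimalMap_of_same_center hρ hpert hm hin).update hmp hne hq
    ((shortcut_self_apply hρ.1 hlen).trans (hin _ _ (hm.1.idem p).symm).symm)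
  refine hpq (Eq.trans ?_ hq)
  rw [← h.ker _ hρ m hm, h.ker _ hpert _ hmoved, Function.update_self,
    Function.update_of_ne hne.symm, hq]

theorem IsMapResilient.exists_hubs (h : IsMapResilient 2 R d C) :
    ∃ m : Fin n → Fin n, (∀ u v, C u = C v → m u = m v) ∧
      ∀ p q, C p ≠ C q → d p (m p) < d p q := by
  have hρ := isMetricPerturbation_const_mul h.metric one_le_two
  obtain ⟨m, hm, hv⟩ := h.voronoi _ hρ.1
  have hker := h.ker _ hρ m hm
  have hv' : ∀ u v, d u (m u) ≤ d u (m v) := fun u v => by linarith [hv u v]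
  refine ⟨m, fun u v => (hker u v).1, fun p q hpq => ?_⟩
  rw [Ne, hker] at hpq
  have hp := h.proximity one_le_two hm hv' (hm.1.idem q) hpq
  have hq := h.proximity one_le_two hm hv' (hm.1.idem p) (Ne.symm hpq)
  linarith [h.metric.triangle p q (m q), h.metric.triangle q p (m p), h.metric.symm p q]

end Separation

/-! ## Trees of Prim's algorithm -/

section Tree

/-- `par` is the parent function of a tree on `1, …, n` with root `1` in which parents precede
their children; the root has the parent `0`, which is not a node. -/
structure IsRootedTree (n : ℕ) (par : ℕ → ℕ) : Prop where
  par_lt : ∀ t, t ≠ 0 → par t < t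
  par_ne_zero : ∀ t, 2 ≤ t → t ≤ n → par t ≠ 0

/-- The node `x` belongs to the subtree of `t`: parents lead from `x` to `t`. -/
def InSubtree (par : ℕ → ℕ) (t x : ℕ) : Prop :=
  Relation.ReflTransGen (fun a b => a ≠ 0 ∧ par a = b) x t

/-- The tree grows by shortest edges, as in Prim's algorithm. -/
def IsGreedyTree (n : ℕ) (D : ℕ → ℕ → ℝ) (par : ℕ → ℕ) : Prop :=
  ∀ t a b, a ≠ 0 → a < t → t ≤ b → b ≤ n → D (par t) t ≤ D a b

variable {n : ℕ} {par : ℕ → ℕ} {t x y : ℕ}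

theorem InSubtree.refl (t : ℕ) : InSubtree par t t := Relation.ReflTransGen.refl

theorem InSubtree.trans (htx : InSubtree par t x) (hxy : InSubtree par x y) : InSubtree par t y :=
  Relation.ReflTransGen.trans hxy htx

theorem inSubtree_iff (hx : x ≠ 0) : InSubtree par t x ↔ t = x ∨ InSubtree par t (par x) := by
  rw [InSubtree, Relation.ReflTransGen.cases_head_iff, eq_comm]
  simp only [hx, ne_eq, not_false_eq_true, true_and, exists_eq_left']
  rfl

theorem inSubtree_zero_iff : InSubtree par t 0 ↔ t = 0 := by
  rw [InSubtree, Relation.ReflTransGen.cases_head_iff, eq_comm]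
  simp

theorem inSubtree_of_par (hx : x ≠ 0) (h : InSubtree par t (par x)) : InSubtree par t x :=
  (inSubtree_iff hx).2 (.inr h)

theorem inSubtree_par_self (hx : x ≠ 0) : InSubtree par (par x) x := inSubtree_of_par hx (.refl _)

theorem InSubtree.ne_zero (h : InSubtree par t x) (ht : t ≠ 0) : x ≠ 0 := by
  rintro rfl
  exact ht (inSubtree_zero_iff.1 h)

theorem InSubtree.comparable {c : ℕ} (hx : InSubtree par x c) (hy : InSubtree par y c) :
    InSubtree par y x ∨ InSubtree par x y :=
  Relation.ReflTransGen.total_of_right_unique (fun _ _ _ h h' => h.2.symm.trans h'.2) hx hy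

namespace IsRootedTree

variable (h : IsRootedTree n par)

include h

theorem le_of_inSubtree (hs : InSubtree par t x) : t ≤ x := by
  induction hs using Relation.ReflTransGen.head_induction_on with
  | refl => exact le_rfl
  | head hstep _ ih => exact ih.trans (hstep.2 ▸ (h.par_lt _ hstep.1).le)

theorem not_inSubtree_par (ht : t ≠ 0) : ¬ InSubtree par t (par t) :=
  fun hs => (h.le_of_inSubtree hs).not_gt (h.par_lt t ht)

theorem inSubtree_one (hx : x ≠ 0) (hxn : x ≤ n) : InSubtree par 1 x := by
  induction x using Nat.strong_induction_on with
  | _ x ih =>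
    rcases eq_or_ne x 1 with rfl | hx1
    · exact .refl 1
    · have hp := h.par_lt x hx
      exact inSubtree_of_par hx (ih _ hp (h.par_ne_zero x (by omega) hxn) (by omega))

theorem exists_crossing (ht : t ≠ 0) (hty : t ≤ y) :
    ∃ s, InSubtree par s y ∧ t ≤ s ∧ par s < t := by
  induction y using Nat.strong_induction_on with
  | _ y ih =>
    rcases lt_or_ge (par y) t with hpy | hpy
    · exact ⟨y, .refl y, hty, hpy⟩
    · obtain ⟨s, hs, hts⟩ := ih _ (h.par_lt y (by omega)) hpy
      exact ⟨s, inSubtree_of_par (by omega) hs, hts⟩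

variable {D : ℕ → ℕ → ℝ} (hsymm : ∀ x y, D x y = D y x) (hg : IsGreedyTree n D par)

include hsymm hg

/-- If `y` is not older than the edge of `t`, then the path from `y` to the root crosses the prefix
of `t` in a later edge, which is at least as long and separates `y` from `x` as well. -/
theorem cut (ht : t ≠ 0) (hy : y ≠ 0) (hxn : x ≤ n) (hyn : y ≤ n) (hx : InSubtree par t x)
    (hty : ¬ InSubtree par t y) : D (par t) t ≤ D x y := by
  induction hm : n - t using Nat.strong_induction_on generalizing t x y with
  | _ m ih =>
    have htx := h.le_of_inSubtree hx
    rcases lt_or_ge y t with hyt | hyt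
    · rw [hsymm x y]
      exact hg t y x hy hyt htx hxn
    · obtain ⟨s, hsy, hts, hps⟩ := h.exists_crossing ht hyt
      have hne : s ≠ t := by rintro rfl; exact hty hsy
      have hsn := (h.le_of_inSubtree hsy).trans hyn
      have hsx : ¬ InSubtree par s x := fun hsx => (hx.comparable hsx).elim
        (fun hst => by have := h.le_of_inSubtree hst; omega) fun hts' => hty (hts'.trans hsy)
      calc D (par t) t ≤ D (par s) s :=
            hg t _ s (h.par_ne_zero s (by omega) hsn) hps hts hsn
        _ ≤ D y x := ih (n - s) (by omega) (by omega) (hx.ne_zero ht) hyn hxn hsy hsx rfl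
        _ = D x y := hsymm y x

variable {S : Set ℕ} {c : ℕ} (hc : c ∈ Set.Icc 1 n)
  (hub : ∀ x ∈ Set.Icc 1 n, ∀ z ∈ Set.Icc 1 n, x ∈ S → z ∉ S → D x c < D x z)

include hc hub

theorem par_mem_of_hub (ht : t ∈ Set.Icc 2 n) (hS : t ∈ S) (htc : ¬ InSubtree par t c) :
    par t ∈ S := by
  by_contra hcon
  obtain ⟨ht2, htn⟩ := ht
  have ht0 : t ≠ 0 := by omega
  have hlt := hub t ⟨by omega, htn⟩ (par t)
    ⟨Nat.pos_of_ne_zero (h.par_ne_zero t ht2 htn), (h.par_lt t ht0).le.trans htn⟩ hS hcon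
  rw [hsymm t (par t)] at hlt
  exact hlt.not_ge (h.cut hsymm hg ht0 (by have := hc.1; omega) htn hc.2 (.refl t) htc)

theorem mem_of_hub (ht : t ∈ Set.Icc 2 n) (hS : par t ∈ S) (htc : InSubtree par t c) : t ∈ S := by
  by_contra hcon
  obtain ⟨ht2, htn⟩ := ht
  have ht0 : t ≠ 0 := by omega
  have hp0 := h.par_ne_zero t ht2 htn
  have hpn := (h.par_lt t ht0).le.trans htn
  have hlt := hub (par t) ⟨Nat.pos_of_ne_zero hp0, hpn⟩ t ⟨by omega, htn⟩ hS hcon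
  rw [hsymm (par t) c] at hlt
  exact hlt.not_ge (h.cut hsymm hg ht0 hp0 hc.2 hpn htc (h.not_inSubtree_par ht0))

theorem mem_of_not_inSubtree_hub (ht : t ≠ 0) (hxn : x ≤ n) (hS : x ∈ S) (htx : InSubtree par t x)
    (htc : ¬ InSubtree par t c) : t ∈ S ∧ par t ∈ S := by
  have h1c := h.inSubtree_one (by have := hc.1; omega) hc.2
  induction htx using Relation.ReflTransGen.head_induction_on with
  | refl =>
    have ht1 : t ≠ 1 := by rintro rfl; exact htc h1c
    exact ⟨hS, h.par_mem_of_hub hsymm hg hc hub ⟨by omega, hxn⟩ hS htc⟩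
  | @head a _ hstep hsub ih =>
    obtain ⟨ha, rfl⟩ := hstep
    have hac : ¬ InSubtree par a c := fun hac => htc (.trans (inSubtree_of_par ha hsub) hac)
    have ha1 : a ≠ 1 := by rintro rfl; exact hac h1c
    exact ih ((h.par_lt a ha).le.trans hxn)
      (h.par_mem_of_hub hsymm hg hc hub ⟨by omega, hxn⟩ hS hac)

theorem mem_of_inSubtree_hub (hx : x ≠ 0) (hS : x ∈ S) (hxt : InSubtree par x t) (hne : x ≠ t)
    (htc : InSubtree par t c) : t ∈ S ∧ par t ∈ S := by
  induction t using Nat.strong_induction_on with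
  | _ t ih =>
    have ht0 := hxt.ne_zero hx
    have hle := h.le_of_inSubtree hxt
    have hS' : par t ∈ S := by
      rcases eq_or_ne x (par t) with rfl | hne'
      · exact hS
      · exact (ih _ (h.par_lt t ht0) (((inSubtree_iff ht0).1 hxt).resolve_left hne) hne'
          ((inSubtree_par_self ht0).trans htc)).1
    exact ⟨h.mem_of_hub hsymm hg hc hub ⟨by omega, (h.le_of_inSubtree htc).trans hc.2⟩ hS' htc, hS'⟩

theorem mem_of_hub_inSubtree (hx : x ∈ Set.Icc 1 n) (hS : x ∈ S) (htx : ¬ InSubtree par t x)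
    (htc : InSubtree par t c) : t ∈ S ∧ par t ∈ S := by
  induction x using Nat.strong_induction_on with
  | _ x ih =>
    have hx0 : x ≠ 0 := by have := hx.1; omega
    by_cases hxc : InSubtree par x c
    · exact h.mem_of_inSubtree_hub hsymm hg hc hub hx0 hS ((htc.comparable hxc).resolve_right htx)
        (by rintro rfl; exact htx (.refl _)) htc
    · have hx1 : x ≠ 1 := by
        rintro rfl
        exact hxc (h.inSubtree_one (by have := hc.1; omega) hc.2)
      have hp := h.par_lt x hx0
      have hp0 := h.par_ne_zero x (by omega) hx.2
      exact ih _ hp ⟨by omega, hp.le.trans hx.2⟩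
        (h.par_mem_of_hub hsymm hg hc hub ⟨by omega, hx.2⟩ hS hxc)
        fun hs => htx (inSubtree_of_par hx0 hs)

/-- One of `x` and `y` is separated from the hub by the edge of `t`, and on the path between this
point and the hub no edge leaves `S`, since it would be no longer than the distance to the hub. -/
theorem edge_subset_of_hub (ht : t ≠ 0) (hxn : x ≤ n) (hy : y ∈ Set.Icc 1 n) (hSx : x ∈ S)
    (hSy : y ∈ S) (htx : InSubtree par t x) (hty : ¬ InSubtree par t y) : t ∈ S ∧ par t ∈ S := by
  by_cases htc : InSubtree par t c
  · exact h.mem_of_hub_inSubtree hsymm hg hc hub hy hSy hty htc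
  · exact h.mem_of_not_inSubtree_hub hsymm hg hc hub ht hxn hSx htx htc

end IsRootedTree

/-! ## Labelings of a tree -/

/-- The local condition on the labels `c` of the parent of `t` and `c'` of `t` which makes each
label the label of a node of its own connected class: a label changes only from outside to inside
the subtree of `t`. -/
def Allowed (par : ℕ → ℕ) (t c c' : ℕ) : Prop :=
  c' = c ∨ (¬ InSubtree par t c ∧ InSubtree par t c')

/-- `φ` labels each node of the tree by a node and satisfies the local conditions. The label `0` of
the missing parent of the root makes the condition at the root void. -/
structure IsTreeLabeling (n : ℕ) (par : ℕ → ℕ) (φ : ℕ → ℕ) : Prop where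
  zero : φ 0 = 0
  mem : ∀ t ∈ Set.Icc 1 n, φ t ∈ Set.Icc 1 n
  allowed : ∀ t ∈ Set.Icc 1 n, Allowed par t (φ (par t)) (φ t)

theorem IsTreeLabeling.eq_of_inSubtree {φ : ℕ → ℕ} (hφ : IsTreeLabeling n par φ)
    (h : IsRootedTree n par) (ht : t ∈ Set.Icc 1 n) (htx : InSubtree par t x)
    (hx : InSubtree par x (φ t)) : φ x = φ t := by
  have hle := (hφ.mem t ht).2
  induction htx using Relation.ReflTransGen.head_induction_on with
  | refl => rfl
  | @head a _ hstep _ ih =>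
    obtain ⟨ha, rfl⟩ := hstep
    have hpar := ih ((inSubtree_par_self ha).trans hx)
    rcases hφ.allowed a ⟨by omega, (h.le_of_inSubtree hx).trans hle⟩ with heq | ⟨hnot, -⟩
    · rw [heq, hpar]
    · rw [hpar] at hnot
      exact absurd hx hnot

theorem IsTreeLabeling.idem {φ : ℕ → ℕ} (hφ : IsTreeLabeling n par φ) (h : IsRootedTree n par)
    (ht : t ∈ Set.Icc 1 n) : φ (φ t) = φ t := by
  induction t using Nat.strong_induction_on with
  | _ t ih =>
    rcases hφ.allowed t ht with heq | ⟨-, hsub⟩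
    · have ht0 : t ≠ 0 := by have := ht.1; omega
      have hp : par t ≠ 0 := fun hp => by
        have := (hφ.mem t ht).1
        rw [heq, hp, hφ.zero] at this
        omega
      rw [heq]
      exact ih _ (h.par_lt t ht0) ⟨by omega, (h.par_lt t ht0).le.trans ht.2⟩
    · exact hφ.eq_of_inSubtree h ht hsub (.refl _)

/-- Only edges between different classes need an argument: since the class of `s` is connected in
the tree, it lies on one side of such an edge. -/
theorem isTreeLabeling_of_hubs (h : IsRootedTree n par) {D : ℕ → ℕ → ℝ}
    (hsymm : ∀ x y, D x y = D y x) (hg : IsGreedyTree n D par) {α : Type*} {κ : ℕ → α}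
    {φ hub : ℕ → ℕ} (hφ0 : φ 0 = 0) (hφmem : ∀ t ∈ Set.Icc 1 n, φ t ∈ Set.Icc 1 n)
    (hκφ : ∀ t ∈ Set.Icc 1 n, κ (φ t) = κ t)
    (hφκ : ∀ s ∈ Set.Icc 1 n, ∀ t ∈ Set.Icc 1 n, κ s = κ t → φ s = φ t)
    (hhubmem : ∀ t ∈ Set.Icc 1 n, hub t ∈ Set.Icc 1 n)
    (hhubκ : ∀ s ∈ Set.Icc 1 n, ∀ t ∈ Set.Icc 1 n, κ s = κ t → hub s = hub t)
    (hhub : ∀ x ∈ Set.Icc 1 n, ∀ z ∈ Set.Icc 1 n, κ x ≠ κ z → D x (hub x) < D x z) :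
    IsTreeLabeling n par φ where
  zero := hφ0
  mem := hφmem
  allowed t ht := by
    have ht0 : t ≠ 0 := by have := ht.1; omega
    rcases eq_or_ne t 1 with rfl | ht1
    · right
      have hp : par 1 = 0 := by have := h.par_lt 1 one_ne_zero; omega
      have hφ1 := hφmem 1 ht
      rw [hp, hφ0, inSubtree_zero_iff]
      exact ⟨one_ne_zero, h.inSubtree_one (by have := hφ1.1; omega) hφ1.2⟩
    have hp0 : par t ≠ 0 := h.par_ne_zero t (by omega) ht.2
    have hp : par t ∈ Set.Icc 1 n := ⟨by omega, (h.par_lt t ht0).le.trans ht.2⟩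
    by_cases hκt : κ t = κ (par t)
    · exact .inl (hφκ _ ht _ hp hκt)
    have hside : ∀ s ∈ Set.Icc 1 n, ∀ x ∈ Set.Icc 1 n, ∀ y ∈ Set.Icc 1 n, κ x = κ s → κ y = κ s →
        InSubtree par t x → InSubtree par t y := by
      intro s hs x hx y hy hxs hys htx
      by_contra hty
      obtain ⟨hS, hpS⟩ := h.edge_subset_of_hub (S := {z | κ z = κ s}) hsymm hg (hhubmem s hs)
        (fun x hx z hz hxS hzS => by
          rw [← hhubκ x hx s hs hxS]
          exact hhub x hx z hz fun hxz => hzS (hxz.symm.trans hxS))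
        ht0 hx.2 hy hxs hys htx hty
      exact hκt (hS.trans hpS.symm)
    exact .inr ⟨fun hsub => h.not_inSubtree_par ht0
      (hside _ hp _ (hφmem _ hp) _ hp (hκφ _ hp) rfl hsub),
      hside t ht t ht _ (hφmem t ht) rfl (hκφ t ht) (.refl t)⟩

end Tree

/-! ## Dynamic programming on rooted trees -/

/-- The first child of `p` that is at least `t`, or `0` if there is none. -/
noncomputable def head (n : ℕ) (par : ℕ → ℕ) (t p : ℕ) : ℕ :=
  sInf {s | t ≤ s ∧ s ≤ n ∧ par s = p}

theorem head_of_lt {n t : ℕ} (par : ℕ → ℕ) (p : ℕ) (ht : n < t) : head n par t p = 0 := by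
  have hempty : {s | t ≤ s ∧ s ≤ n ∧ par s = p} = ∅ := by
    ext s
    simp only [Set.mem_ofPred_eq, Set.mem_empty_iff_false, iff_false]
    omega
  rw [head, hempty, Nat.sInf_empty]

theorem head_eq_update {n t : ℕ} (par : ℕ → ℕ) (ht : t ≤ n) :
    head n par t = Function.update (head n par (t + 1)) (par t) t := by
  funext p
  rcases eq_or_ne p (par t) with rfl | hp
  · rw [Function.update_self]
    exact le_antisymm (Nat.sInf_le ⟨le_rfl, ht, rfl⟩)
      (Nat.sInf_mem (s := {s | t ≤ s ∧ s ≤ n ∧ par s = par t}) ⟨t, le_rfl, ht, rfl⟩).1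
  · rw [Function.update_of_ne hp, head, head]
    congr 1
    ext s
    have : par s = p → t ≠ s := by rintro rfl rfl; exact hp rfl
    simp only [Set.mem_ofPred_eq, Nat.succ_le_iff, lt_iff_le_and_ne]
    tauto

section Fold

variable {M : Type*} (op : M → M → M) [Std.Commutative op] [Std.Associative op] (e : M)

theorem fold_range_eq_op {A A' : ℕ → M} {w : M} {p t : ℕ} (hp : p < t)
    (hne : ∀ q < t, q ≠ p → A' q = A q) (hA' : A' p = op (op w (A t)) (A p)) :
    (Finset.range t).fold op e A' = op w ((Finset.range (t + 1)).fold op e A) := by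
  have hmem : p ∈ Finset.range t := Finset.mem_range.2 hp
  rw [Finset.range_add_one, Finset.fold_insert Finset.notMem_range_self, ← Finset.insert_erase hmem,
    Finset.fold_insert (Finset.notMem_erase _ _), Finset.fold_insert (Finset.notMem_erase _ _), hA',
    Finset.fold_congr (g := A) fun q hq => hne q (Finset.mem_range.1 (Finset.mem_of_mem_erase hq))
      (Finset.ne_of_mem_erase hq)]
  simp only [Std.Associative.assoc (op := op)]

variable {op e} (he : op e e = e) (s : Finset ℕ)

include he

theorem fold_const_of_idem : s.fold op e (fun _ => e) = e := by
  induction s using Finset.induction_on with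
  | empty => rfl
  | insert a s ha ih => rw [Finset.fold_insert ha, ih, he]

theorem op_fold_of_idem (f : ℕ → M) : op (s.fold op e f) e = s.fold op e f := by
  induction s using Finset.induction_on with
  | empty => exact he
  | insert a s ha ih => rw [Finset.fold_insert ha, Std.Associative.assoc (op := op), ih]

end Fold

theorem sum_range_eq_add {A A' : ℕ → ℕ} {w p t : ℕ} (hp : p < t)
    (hne : ∀ q < t, q ≠ p → A' q = A q) (hA' : A' p = w + A t + A p) :
    ∑ q ∈ Finset.range t, A' q = w + ∑ q ∈ Finset.range (t + 1), A q := by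
  simp only [Finset.sum_eq_fold]
  exact fold_range_eq_op (· + ·) 0 hp hne hA'

/-- `1` if the label `c` makes the node `t` a center, and `0` otherwise. -/
def selfCount (t c : ℕ) : ℕ := if c = t then 1 else 0

/-- The number of centers of a labeling of `1, …, n`. -/
def centerCount (n : ℕ) (φ : ℕ → ℕ) : ℕ := ∑ t ∈ Finset.Ico 1 (n + 1), selfCount t (φ t)

/-- The cost of a labeling of `1, …, n`. -/
noncomputable def labelCost (n : ℕ) (op : ℝ → ℝ → ℝ) [Std.Commutative op] [Std.Associative op]
    (e : ℝ) (own : ℕ → ℕ → ℝ) (φ : ℕ → ℕ) : ℝ :=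
  (Finset.Ico 1 (n + 1)).fold op e fun t => own t (φ t)

/-- `x` minimizes `F` over `S` and `v` is the minimum, if `found` holds; otherwise `S` is empty. -/
structure IsBest {ι : Type*} (S : Set ι) (F : ι → ℝ) (found : Prop) (x : ι) (v : ℝ) : Prop where
  found_of_mem : ∀ y ∈ S, found
  mem : found → x ∈ S
  val_eq : found → v = F x
  le : ∀ y ∈ S, v ≤ F y

/-- The table of the dynamic program. The entry `(t, j, c)` stands for the labelings of the
subtrees of `t` and of its later siblings that have `j` centers, where `c` is the label of the
parent of `t`: it says if they exist, their smallest cost, and for a labeling of smallest cost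
the label of `t` and the number of centers strictly below `t`. -/
structure Table where
  feas : ℕ → ℕ → ℕ → Prop
  val : ℕ → ℕ → ℕ → ℝ
  label : ℕ → ℕ → ℕ → ℕ
  below : ℕ → ℕ → ℕ → ℕ

section DP

variable (n : ℕ) (par : ℕ → ℕ) (op : ℝ → ℝ → ℝ) (e : ℝ) (own : ℕ → ℕ → ℝ)

/-- The number of centers that remain for the later siblings of `t` when `t` gets the label `x.1`
and `x.2` of the `j` centers are strictly below `t`. -/
def laterCount (t j : ℕ) (x : ℕ × ℕ) : ℕ := j - (selfCount t x.1 + x.2)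

/-- The choices of a label of `t` and of a number of centers strictly below `t` that are possible
in the entry `(t, j, c)`. -/
def Table.choices (B : Table) (t j c : ℕ) : Set (ℕ × ℕ) :=
  {x | x.1 ∈ Set.Icc 1 n ∧ Allowed par t c x.1 ∧ selfCount t x.1 + x.2 ≤ j ∧
    B.feas (head n par (t + 1) t) x.2 x.1 ∧
    B.feas (head n par (t + 1) (par t)) (laterCount t j x) c}

/-- The cost of a choice in the entry `(t, j, c)`. -/
noncomputable def Table.choiceCost (B : Table) (t j c : ℕ) (x : ℕ × ℕ) : ℝ :=
  op (op (own t x.1) (B.val (head n par (t + 1) t) x.2 x.1))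
    (B.val (head n par (t + 1) (par t)) (laterCount t j x) c)

/-- The entries for the empty set of subtrees, which have the index `0`. -/
structure Table.Null (B : Table) : Prop where
  feas : ∀ j ≤ n, ∀ c ≤ n, (B.feas 0 j c ↔ j = 0)
  val : ∀ c ≤ n, B.val 0 0 c = e

/-- The entry `(t, j, c)` of the table `B'` is a best choice with respect to the table `B`. -/
def Table.BestEntry (B B' : Table) (t j c : ℕ) : Prop :=
  IsBest (B.choices n par t j c) (B.choiceCost n par op own t j c) (B'.feas t j c)
    (B'.label t j c, B'.below t j c) (B'.val t j c)

/-- The entries for `t` are the best choices. -/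
def Table.Row (B : Table) (t : ℕ) : Prop :=
  ∀ j ≤ n, ∀ c ≤ n, B.BestEntry n par op own B t j c

/-- All entries of the table are correct. -/
structure Table.Correct (B : Table) : Prop where
  null : B.Null n e
  row : ∀ t ∈ Set.Icc 1 n, B.Row n par op own t

variable {n par op e own} {B : Table} {φ ψ : ℕ → ℕ}

theorem selfCount_le_one (t c : ℕ) : selfCount t c ≤ 1 := by
  unfold selfCount
  split <;> omega

theorem centerCount_eq_card (n : ℕ) (φ : ℕ → ℕ) :
    centerCount n φ = {t ∈ Finset.Ico 1 (n + 1) | φ t = t}.card :=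
  (Finset.card_filter _ _).symm

theorem IsTreeLabeling.le (hφ : IsTreeLabeling n par φ) {p : ℕ} (hp : p ≤ n) : φ p ≤ n := by
  rcases Nat.eq_zero_or_pos p with rfl | hp0
  · exact hφ.zero.trans_le (Nat.zero_le n)
  · exact (hφ.mem p ⟨hp0, hp⟩).2

variable [Std.Commutative op] [Std.Associative op]

section LowerBound

variable (n par op e own) in
/-- The subtrees of the children of `p` that are at least `t` have `N p` centers and the cost `W p`
in the labeling `φ`, and the entries of the table are at most `W`. -/
structure Table.Dominates (B : Table) (φ : ℕ → ℕ) (t : ℕ) (N : ℕ → ℕ) (W : ℕ → ℝ) : Prop where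
  feas : ∀ p < t, B.feas (head n par t p) (N p) (φ p)
  val_le : ∀ p < t, B.val (head n par t p) (N p) (φ p) ≤ W p
  count : ∑ p ∈ Finset.range t, N p = ∑ s ∈ Finset.Ico t (n + 1), selfCount s (φ s)
  cost : (Finset.range t).fold op e W = (Finset.Ico t (n + 1)).fold op e fun s => own s (φ s)

theorem sum_selfCount_le (φ : ℕ → ℕ) {t : ℕ} (ht : 1 ≤ t) :
    ∑ s ∈ Finset.Ico t (n + 1), selfCount s (φ s) ≤ n :=
  calc ∑ s ∈ Finset.Ico t (n + 1), selfCount s (φ s)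
    _ ≤ (Finset.Ico t (n + 1)).card • 1 :=
        Finset.sum_le_card_nsmul _ _ _ fun _ _ => selfCount_le_one _ _
    _ ≤ n := by rw [Nat.card_Ico, smul_eq_mul]; omega

omit [Std.Commutative op] [Std.Associative op] in
theorem Table.Row.relax {t c c' j₁ j₂ : ℕ} (hrow : B.Row n par op own t) (hc : c ≤ n)
    (hc' : c' ∈ Set.Icc 1 n) (hj : selfCount t c' + j₁ + j₂ ≤ n) (hall : Allowed par t c c')
    (h₁ : B.feas (head n par (t + 1) t) j₁ c') (h₂ : B.feas (head n par (t + 1) (par t)) j₂ c) :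
    B.feas t (selfCount t c' + j₁ + j₂) c ∧ B.val t (selfCount t c' + j₁ + j₂) c ≤
      op (op (own t c') (B.val (head n par (t + 1) t) j₁ c'))
        (B.val (head n par (t + 1) (par t)) j₂ c) := by
  have hbest := hrow _ hj c hc
  have hlater : laterCount t (selfCount t c' + j₁ + j₂) (c', j₁) = j₂ := by
    rw [laterCount, Nat.add_sub_cancel_left]
  have hchoice : (c', j₁) ∈ B.choices n par t (selfCount t c' + j₁ + j₂) c :=
    ⟨hc', hall, Nat.le_add_right _ _, h₁, by rwa [hlater]⟩
  refine ⟨hbest.found_of_mem _ hchoice, (hbest.le _ hchoice).trans_eq ?_⟩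
  rw [Table.choiceCost, hlater]

variable (hmono : ∀ ⦃a b c d⦄, a ≤ b → c ≤ d → op a c ≤ op b d) (he : op e e = e)
  (hB : B.Correct n par op e own) (h : IsRootedTree n par) (hφ : IsTreeLabeling n par φ)

include hφ

include he in
theorem Table.Null.dominates (hnull : B.Null n e) :
    B.Dominates n par op e own φ (n + 1) (fun _ => 0) fun _ => e where
  feas p hp := by
    rw [head_of_lt par p n.lt_succ_self]
    exact (hnull.feas 0 (Nat.zero_le n) _ (hφ.le (Nat.lt_succ_iff.1 hp))).2 rfl
  val_le p hp := by
    rw [head_of_lt par p n.lt_succ_self]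
    exact (hnull.val _ (hφ.le (Nat.lt_succ_iff.1 hp))).le
  count := by simp
  cost := by rw [fold_const_of_idem he, Finset.Ico_self, Finset.fold_empty]

include hmono h in
theorem Table.Row.dominates {t : ℕ} {N : ℕ → ℕ} {W : ℕ → ℝ} (ht : t ∈ Set.Icc 1 n)
    (hrow : B.Row n par op own t) (hdom : B.Dominates n par op e own φ (t + 1) N W) :
    B.Dominates n par op e own φ t
      (Function.update N (par t) (selfCount t (φ t) + N t + N (par t)))
      (Function.update W (par t) (op (op (own t (φ t)) (W t)) (W (par t)))) := by
  have hp : par t < t := h.par_lt t (Nat.ne_of_gt ht.1)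
  have hcard : Finset.Ico t (n + 1) = insert t (Finset.Ico (t + 1) (n + 1)) :=
    (Finset.insert_Ico_add_one_left_eq_Ico (Nat.lt_succ_of_le ht.2)).symm
  have hcount : ∑ p ∈ Finset.range t,
      Function.update N (par t) (selfCount t (φ t) + N t + N (par t)) p =
      ∑ s ∈ Finset.Ico t (n + 1), selfCount s (φ s) := by
    rw [hcard, Finset.sum_insert (by simp), ← hdom.count]
    exact sum_range_eq_add hp (fun q _ hq => Function.update_of_ne hq _ _) (by simp)
  have hcost : (Finset.range t).fold op e
      (Function.update W (par t) (op (op (own t (φ t)) (W t)) (W (par t)))) =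
      (Finset.Ico t (n + 1)).fold op e fun s => own s (φ s) := by
    rw [hcard, Finset.fold_insert (by simp), ← hdom.cost]
    exact fold_range_eq_op op e hp (fun q _ hq => Function.update_of_ne hq _ _) (by simp)
  have hle : selfCount t (φ t) + N t + N (par t) ≤ n := by
    refine le_trans ?_ (hcount.trans_le (sum_selfCount_le φ ht.1))
    refine le_trans ?_ (Finset.single_le_sum (fun _ _ => Nat.zero_le _) (Finset.mem_range.2 hp))
    rw [Function.update_self]
  obtain ⟨hfeas, hval⟩ := hrow.relax (hφ.le (hp.le.trans ht.2)) (hφ.mem t ht) hle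
    (hφ.allowed t ht) (hdom.feas t t.lt_succ_self) (hdom.feas _ (hp.trans t.lt_succ_self))
  refine ⟨fun p hpt => ?_, fun p hpt => ?_, hcount, hcost⟩ <;>
    rcases eq_or_ne p (par t) with rfl | hne
  · rw [head_eq_update par ht.2, Function.update_self, Function.update_self]
    exact hfeas
  · rw [head_eq_update par ht.2, Function.update_of_ne hne, Function.update_of_ne hne]
    exact hdom.feas p (by omega)
  · rw [head_eq_update par ht.2, Function.update_self, Function.update_self, Function.update_self]
    exact hval.trans (hmono (hmono le_rfl (hdom.val_le t t.lt_succ_self))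
      (hdom.val_le _ (hp.trans t.lt_succ_self)))
  · rw [head_eq_update par ht.2, Function.update_of_ne hne, Function.update_of_ne hne,
      Function.update_of_ne hne]
    exact hdom.val_le p (by omega)

include hmono he hB h in
theorem Table.Correct.exists_dominates {t : ℕ} (ht : 1 ≤ t) (htn : t ≤ n + 1) :
    ∃ N W, B.Dominates n par op e own φ t N W := by
  refine Nat.decreasingInduction' (fun s hs hts ⟨N, W, hdom⟩ => ?_) htn
    ⟨_, _, hB.null.dominates he hφ⟩
  have hsn : s ∈ Set.Icc 1 n := ⟨ht.trans hts, Nat.lt_succ_iff.1 hs⟩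
  exact ⟨_, _, (hB.row s hsn).dominates hmono h hφ hsn hdom⟩

include hmono he hB h in
theorem Table.Correct.le_labelCost :
    B.feas (head n par 1 0) (centerCount n φ) 0 ∧
      op (B.val (head n par 1 0) (centerCount n φ) 0) e ≤ labelCost n op e own φ := by
  obtain ⟨N, W, hdom⟩ := hB.exists_dominates hmono he h hφ le_rfl (Nat.le_add_left 1 n)
  have hcount : N 0 = centerCount n φ := by rw [centerCount, ← hdom.count, Finset.sum_range_one]
  have hfeas := hdom.feas 0 one_pos
  have hval := hdom.val_le 0 one_pos
  rw [hφ.zero, hcount] at hfeas hval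
  refine ⟨hfeas, (hmono hval le_rfl).trans_eq ?_⟩
  rw [labelCost, ← hdom.cost, Finset.range_one, Finset.fold_singleton]

end LowerBound

variable (n par op e own) in
/-- The labeling `φ` has `k` centers, and its cost is the least possible. -/
structure IsOptimalLabeling (k : ℕ) (φ : ℕ → ℕ) : Prop where
  isTreeLabeling : IsTreeLabeling n par φ
  centerCount_eq : centerCount n φ = k
  labelCost_le : ∀ ψ, IsTreeLabeling n par ψ → centerCount n ψ = k →
    labelCost n op e own φ ≤ labelCost n op e own ψ

variable (n par op e own) in
/-- The state of the construction of a labeling with `k` centers from the table, after the nodes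
less than `t` have been labeled: `K p` is the number of centers in the subtrees of the remaining
children of `p`. -/
structure Table.PartialLabeling (B : Table) (k t : ℕ) (K φ : ℕ → ℕ) : Prop where
  zero : φ 0 = 0
  mem : ∀ s ∈ Set.Ico 1 t, φ s ∈ Set.Icc 1 n
  allowed : ∀ s ∈ Set.Ico 1 t, Allowed par s (φ (par s)) (φ s)
  feas : ∀ p < t, B.feas (head n par t p) (K p) (φ p)
  count : ∑ s ∈ Finset.Ico 1 t, selfCount s (φ s) + ∑ p ∈ Finset.range t, K p = k
  cost : op ((Finset.Ico 1 t).fold op e fun s => own s (φ s))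
    ((Finset.range t).fold op e fun p => B.val (head n par t p) (K p) (φ p)) =
    op (B.val (head n par 1 0) k 0) e

namespace Table.PartialLabeling

theorem init (he : op e e = e) {k : ℕ} {K : ℕ → ℕ} (hf : B.feas (head n par 1 0) k 0)
    (hK : K 0 = k) (hφ : φ 0 = 0) : B.PartialLabeling n par op e own k 1 K φ where
  zero := hφ
  mem s hs := absurd hs.2 hs.1.not_gt
  allowed s hs := absurd hs.2 hs.1.not_gt
  feas p hp := by
    obtain rfl := Nat.lt_one_iff.1 hp
    rwa [hK, hφ]
  count := by simpa using hK
  cost := by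
    simp only [Finset.Ico_self, Finset.fold_empty, Finset.range_one, Finset.fold_singleton, hK, hφ]
    rw [Std.Commutative.comm (op := op) e, Std.Associative.assoc (op := op), he]

variable {k t : ℕ} {K : ℕ → ℕ}

theorem le (hP : B.PartialLabeling n par op e own k t K φ) {p : ℕ} (hp : p < t) : K p ≤ k := by
  have := Finset.single_le_sum (fun _ _ => Nat.zero_le _) (Finset.mem_range.2 hp) (f := K)
  have := hP.count
  omega

theorem label_le (hP : B.PartialLabeling n par op e own k t K φ) {p : ℕ} (hp : p < t) :
    φ p ≤ n := by
  rcases Nat.eq_zero_or_pos p with rfl | hp0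
  · exact hP.zero.trans_le (Nat.zero_le n)
  · exact (hP.mem p ⟨hp0, hp⟩).2

section Step

variable (h : IsRootedTree n par) (ht : t ∈ Set.Icc 1 n)
  (hP : B.PartialLabeling n par op e own k t K φ) {x : ℕ × ℕ}
  (hx : x ∈ B.choices n par t (K (par t)) (φ (par t)))

include h ht hP hx

theorem step_count :
    ∑ s ∈ Finset.Ico 1 (t + 1), selfCount s (Function.update φ t x.1 s) +
      ∑ p ∈ Finset.range (t + 1), Function.update (Function.update K t x.2) (par t)
        (laterCount t (K (par t)) x) p = k := by
  have hp : par t < t := h.par_lt t (Nat.ne_of_gt ht.1)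
  rw [← hP.count, Finset.sum_Ico_succ_top ht.1, Function.update_self,
    Finset.sum_congr rfl fun s hs => by rw [Function.update_of_ne (Finset.mem_Ico.1 hs).2.ne],
    add_assoc]
  congr 1
  refine (sum_range_eq_add hp (fun q hq hqp => ?_) ?_).symm
  · rw [Function.update_of_ne hqp, Function.update_of_ne hq.ne]
  · rw [Function.update_self, Function.update_of_ne hp.ne', Function.update_self, laterCount]
    have := hx.2.2.1
    omega

omit hx in
theorem step_cost (hval : B.val t (K (par t)) (φ (par t)) =
      B.choiceCost n par op own t (K (par t)) (φ (par t)) x) :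
    op ((Finset.Ico 1 (t + 1)).fold op e fun s => own s (Function.update φ t x.1 s))
      ((Finset.range (t + 1)).fold op e fun p => B.val (head n par (t + 1) p)
        (Function.update (Function.update K t x.2) (par t) (laterCount t (K (par t)) x) p)
        (Function.update φ t x.1 p)) = op (B.val (head n par 1 0) k 0) e := by
  have hp : par t < t := h.par_lt t (Nat.ne_of_gt ht.1)
  rw [← hP.cost, ← Finset.insert_Ico_right_eq_Ico_add_one ht.1, Finset.fold_insert (by simp),
    Function.update_self,
    Finset.fold_congr fun s hs => by rw [Function.update_of_ne (Finset.mem_Ico.1 hs).2.ne],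
    Std.Commutative.comm (op := op) (own t x.1), Std.Associative.assoc (op := op)]
  congr 1
  refine (fold_range_eq_op op e hp (fun q hq hqp => ?_) ?_).symm
  · rw [head_eq_update par ht.2, Function.update_of_ne hqp, Function.update_of_ne hqp,
      Function.update_of_ne hq.ne, Function.update_of_ne hq.ne]
  · rw [head_eq_update par ht.2, Function.update_self, hval, Function.update_self,
      Function.update_self, Function.update_of_ne hp.ne', Function.update_self,
      Function.update_of_ne hp.ne, Table.choiceCost]

theorem update_of_choice (hval : B.val t (K (par t)) (φ (par t)) =
      B.choiceCost n par op own t (K (par t)) (φ (par t)) x) :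
    B.PartialLabeling n par op e own k (t + 1)
      (Function.update (Function.update K t x.2) (par t) (laterCount t (K (par t)) x))
      (Function.update φ t x.1) where
  zero := by rw [Function.update_of_ne (Nat.ne_of_lt ht.1), hP.zero]
  mem s hs := by
    rcases Nat.lt_succ_iff_lt_or_eq.1 hs.2 with hst | rfl
    · rw [Function.update_of_ne hst.ne]
      exact hP.mem s ⟨hs.1, hst⟩
    · rw [Function.update_self]
      exact hx.1
  allowed s hs := by
    have hps : par s < s := h.par_lt s (Nat.ne_of_gt hs.1)
    rcases Nat.lt_succ_iff_lt_or_eq.1 hs.2 with hst | rfl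
    · rw [Function.update_of_ne hst.ne, Function.update_of_ne (hps.trans hst).ne]
      exact hP.allowed s ⟨hs.1, hst⟩
    · rw [Function.update_of_ne hps.ne, Function.update_self]
      exact hx.2.1
  feas p hpt := by
    have hp : par t < t := h.par_lt t (Nat.ne_of_gt ht.1)
    rcases Nat.lt_succ_iff_lt_or_eq.1 hpt with hlt | rfl
    · rw [Function.update_of_ne hlt.ne (f := φ)]
      rcases eq_or_ne p (par t) with rfl | hne
      · rw [Function.update_self]
        exact hx.2.2.2.2
      · rw [Function.update_of_ne hne, Function.update_of_ne hlt.ne]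
        have hfeas := hP.feas p hlt
        rwa [head_eq_update par ht.2, Function.update_of_ne hne] at hfeas
    · rw [Function.update_self, Function.update_of_ne hp.ne', Function.update_self]
      exact hx.2.2.2.1
  count := hP.step_count h ht hx
  cost := hP.step_cost h ht hval

end Step

theorem step (hB : B.Correct n par op e own) (h : IsRootedTree n par) (ht : t ∈ Set.Icc 1 n)
    (hk : k ≤ n) (hP : B.PartialLabeling n par op e own k t K φ) :
    B.PartialLabeling n par op e own k (t + 1)
      (Function.update (Function.update K t (B.below t (K (par t)) (φ (par t)))) (par t)
        (laterCount t (K (par t))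
          (B.label t (K (par t)) (φ (par t)), B.below t (K (par t)) (φ (par t)))))
      (Function.update φ t (B.label t (K (par t)) (φ (par t)))) := by
  have hp : par t < t := h.par_lt t (Nat.ne_of_gt ht.1)
  have hbest := hB.row t ht _ ((hP.le hp).trans hk) _ (hP.label_le hp)
  have hfeas : B.feas t (K (par t)) (φ (par t)) := by
    have := hP.feas _ hp
    rwa [head_eq_update par ht.2, Function.update_self] at this
  exact hP.update_of_choice h ht (hbest.mem hfeas) (hbest.val_eq hfeas)

variable (hP : B.PartialLabeling n par op e own k (n + 1) K φ)

include hP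

theorem isTreeLabeling : IsTreeLabeling n par φ :=
  ⟨hP.zero, fun s hs => hP.mem s ⟨hs.1, Nat.lt_succ_of_le hs.2⟩,
    fun s hs => hP.allowed s ⟨hs.1, Nat.lt_succ_of_le hs.2⟩⟩

variable (hk : k ≤ n)

include hk

theorem remaining_eq_zero (hnull : B.Null n e) {p : ℕ} (hp : p ∈ Finset.range (n + 1)) :
    K p = 0 := by
  have hpn := Finset.mem_range.1 hp
  have hfeas := hP.feas p hpn
  rw [head_of_lt par p n.lt_succ_self] at hfeas
  exact (hnull.feas _ ((hP.le hpn).trans hk) _ (hP.label_le hpn)).1 hfeas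

theorem centerCount_eq (hnull : B.Null n e) : centerCount n φ = k := by
  rw [← hP.count, Finset.sum_eq_zero (s := Finset.range (n + 1)) fun p hp =>
    hP.remaining_eq_zero hk hnull hp]
  rfl

theorem isOptimalLabeling (hmono : ∀ ⦃a b c d⦄, a ≤ b → c ≤ d → op a c ≤ op b d)
    (he : op e e = e) (hB : B.Correct n par op e own) (h : IsRootedTree n par) :
    IsOptimalLabeling n par op e own k φ := by
  refine ⟨hP.isTreeLabeling, hP.centerCount_eq hk hB.null, fun ψ hψ hψk => ?_⟩
  have hle := (hB.le_labelCost hmono he h hψ).2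
  have hval : ∀ p ∈ Finset.range (n + 1), B.val (head n par (n + 1) p) (K p) (φ p) = e := by
    intro p hp
    rw [head_of_lt par p n.lt_succ_self, hP.remaining_eq_zero hk hB.null hp]
    exact hB.null.val _ (hP.label_le (Finset.mem_range.1 hp))
  rwa [hψk, ← hP.cost, Finset.fold_congr hval, fold_const_of_idem he, op_fold_of_idem he] at hle

end Table.PartialLabeling

end DP

/-! ## Programs with bounded loops -/

/-- The memory after the natural number `v` is written to the cell `x`. -/
def Store.putNat (s : Store) (x : Cell) (v : ℕ) : Store :=
  { s with nat := Function.update s.nat x v }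

/-- The memory after the real number `v` is written to the cell `x`. -/
noncomputable def Store.putReal (s : Store) (x : Cell) (v : ℝ) : Store :=
  { s with real := Function.update s.real x v }

@[simp] theorem Store.putNat_nat (s : Store) (x y : Cell) (v : ℕ) :
    (s.putNat x v).nat y = if y = x then v else s.nat y := Function.update_apply _ _ _ _

@[simp] theorem Store.putNat_real (s : Store) (x : Cell) (v : ℕ) :
    (s.putNat x v).real = s.real := rfl

@[simp] theorem Store.putReal_real (s : Store) (x y : Cell) (v : ℝ) :
    (s.putReal x v).real y = if y = x then v else s.real y := Function.update_apply _ _ _ _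

@[simp] theorem Store.putReal_nat (s : Store) (x : Cell) (v : ℝ) :
    (s.putReal x v).nat = s.nat := rfl

/-- The natural variable `a`, which is the first cell of the array `a`. -/
def NExp.var (a : ℕ) : NExp := .get a (.lit 0) (.lit 0) (.lit 0)

/-- The entry `i` of the natural array `a`. -/
def NExp.at (a : ℕ) (i : NExp) : NExp := .get a i (.lit 0) (.lit 0)

/-- The real variable `a`, which is the first cell of the array `a`. -/
def RExp.var (a : ℕ) : RExp := .get a (.lit 0) (.lit 0) (.lit 0)

/-- Programs in which each loop has a counter `a` that runs through the numbers `0, …, n`. They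
halt after polynomially many steps. -/
inductive Blk
  | skip
  | setNat (a : ℕ) (i j l e : NExp)
  | setReal (a : ℕ) (i j l : NExp) (e : RExp)
  | seq (p q : Blk)
  | branch (b : BExp) (p q : Blk)
  | loop (a : ℕ) (p : Blk)

namespace Blk

infixr:65 " ;; " => Blk.seq

/-- Assignment to a natural variable. -/
def letNat (a : ℕ) (e : NExp) : Blk := .setNat a (.lit 0) (.lit 0) (.lit 0) e

/-- Assignment to an entry of a natural array. -/
def setAt (a : ℕ) (i e : NExp) : Blk := .setNat a i (.lit 0) (.lit 0) e

/-- Assignment to a real variable. -/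
def letReal (a : ℕ) (e : RExp) : Blk := .setReal a (.lit 0) (.lit 0) (.lit 0) e

/-- The while loop of the machine that counts `a` up to `n`. -/
def compileLoop (a : ℕ) (p : Prog) : Prog :=
  .loop (.natLt (.var a) (.add .size (.lit 1)))
    (.seq p (.setNat a (.lit 0) (.lit 0) (.lit 0) (.add (.var a) (.lit 1))))

/-- Translation to the machine model. -/
def compile : Blk → Prog
  | skip => .skip
  | setNat a i j l e => .setNat a i j l e
  | setReal a i j l e => .setReal a i j l e
  | seq p q => .seq p.compile q.compile
  | branch b p q => .branch b p.compile q.compile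
  | loop a p => .seq (.setNat a (.lit 0) (.lit 0) (.lit 0) (.lit 0)) (compileLoop a p.compile)

/-- The memory after `m` rounds of a loop with counter `a` whose body has the effect `f`. -/
def rounds (a : ℕ) (f : Store → Store) (s : Store) : ℕ → Store
  | 0 => s.putNat (a, 0, 0, 0) 0
  | m + 1 => (f (rounds a f s m)).putNat (a, 0, 0, 0) (m + 1)

open Classical in
/-- The memory after the execution of a program. -/
noncomputable def exec (I : Input) : Blk → Store → Store
  | skip, s => s
  | setNat a i j l e, s => s.putNat (a, i.eval I s, j.eval I s, l.eval I s) (e.eval I s)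
  | setReal a i j l e, s => s.putReal (a, i.eval I s, j.eval I s, l.eval I s) (e.eval I s)
  | seq p q, s => q.exec I (p.exec I s)
  | branch b p q, s => if b.Holds I s then p.exec I s else q.exec I s
  | loop a p, s => rounds a (p.exec I) s (I.size + 1)

/-- The names of the arrays that a program may change. -/
def writes : Blk → List ℕ
  | skip => []
  | setNat a _ _ _ _ => [a]
  | setReal a _ _ _ _ => [a]
  | seq p q => p.writes ++ q.writes
  | branch _ p q => p.writes ++ q.writes
  | loop a p => a :: p.writes

/-- The bodies of the loops do not change the counters. -/
def WellFormed : Blk → Prop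
  | skip => True
  | setNat _ _ _ _ _ => True
  | setReal _ _ _ _ _ => True
  | seq p q => p.WellFormed ∧ q.WellFormed
  | branch _ p q => p.WellFormed ∧ q.WellFormed
  | loop a p => a ∉ p.writes ∧ p.WellFormed

open Polynomial in
/-- A bound for the number of steps, as a polynomial in the size of the input. -/
noncomputable def bound : Blk → Polynomial ℕ
  | skip => C 1
  | setNat _ i j l e => C (i.steps + j.steps + l.steps + e.steps + 1)
  | setReal _ i j l e => C (i.steps + j.steps + l.steps + e.steps + 1)
  | seq p q => p.bound + q.bound
  | branch b p q => C (b.steps + 1) + p.bound + q.bound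
  | loop _ p => (X + 1) * (p.bound + C 20) + C 15

end Blk

/-- The memories agree on all arrays whose names are not in `L`. -/
def Store.EqOff (L : List ℕ) (s s' : Store) : Prop :=
  ∀ a ∉ L, ∀ x, s.nat (a, x) = s'.nat (a, x) ∧ s.real (a, x) = s'.real (a, x)

theorem Store.EqOff.refl (L : List ℕ) (s : Store) : s.EqOff L s := fun _ _ _ => ⟨rfl, rfl⟩

theorem Store.EqOff.trans {L : List ℕ} {s₁ s₂ s₃ : Store} (h : s₁.EqOff L s₂)
    (h' : s₂.EqOff L s₃) : s₁.EqOff L s₃ := fun a ha x =>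
  ⟨(h a ha x).1.trans (h' a ha x).1, (h a ha x).2.trans (h' a ha x).2⟩

theorem Store.EqOff.mono {L L' : List ℕ} {s₁ s₂ : Store} (h : s₁.EqOff L s₂) (hL : L ⊆ L') :
    s₁.EqOff L' s₂ := fun a ha => h a fun ha' => ha (hL ha')

theorem Store.putNat_eqOff {L : List ℕ} {a : ℕ} (ha : a ∈ L) (s : Store) (x : ℕ × ℕ × ℕ) (v : ℕ) :
    (s.putNat (a, x) v).EqOff L s := fun b hb y => by
  simp [ne_of_mem_of_not_mem ha hb |>.symm]

theorem Store.putReal_eqOff {L : List ℕ} {a : ℕ} (ha : a ∈ L) (s : Store) (x : ℕ × ℕ × ℕ) (v : ℝ) :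
    (s.putReal (a, x) v).EqOff L s := fun b hb y => by
  simp [ne_of_mem_of_not_mem ha hb |>.symm]

namespace Blk

variable {I : Input}

theorem rounds_counter (a : ℕ) (f : Store → Store) (s : Store) (m : ℕ) :
    (rounds a f s m).nat (a, 0, 0, 0) = m := by
  cases m <;> simp [rounds]

theorem rounds_eqOff {a : ℕ} {L : List ℕ} {f : Store → Store} (ha : a ∈ L)
    (hf : ∀ s, (f s).EqOff L s) (s : Store) (m : ℕ) : (rounds a f s m).EqOff L s := by
  induction m with
  | zero => exact Store.putNat_eqOff ha _ _ _
  | succ m ih => exact (Store.putNat_eqOff ha _ _ _).trans ((hf _).trans ih)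

theorem exec_eqOff (p : Blk) (s : Store) : (p.exec I s).EqOff p.writes s := by
  induction p generalizing s with
  | skip => exact .refl _ _
  | setNat a i j l e => exact Store.putNat_eqOff (List.mem_singleton_self a) _ _ _
  | setReal a i j l e => exact Store.putReal_eqOff (List.mem_singleton_self a) _ _ _
  | seq p q hp hq =>
    exact ((hq _).mono (List.subset_append_right _ _)).trans
      ((hp s).mono (List.subset_append_left _ _))
  | branch b p q hp hq =>
    simp only [exec]
    split_ifs
    · exact (hp s).mono (List.subset_append_left _ _)
    · exact (hq s).mono (List.subset_append_right _ _)
  | loop a p hp =>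
    exact rounds_eqOff List.mem_cons_self (fun s => (hp s).mono (List.subset_cons_self _ _)) s _

theorem exec_loop_invariant {a : ℕ} {p : Blk} {s : Store} (Inv : ℕ → Store → Prop)
    (h0 : Inv 0 s) (hput : ∀ i s' v, Inv i s' → Inv i (s'.putNat (a, 0, 0, 0) v))
    (hstep : ∀ i s', i ≤ I.size → s'.nat (a, 0, 0, 0) = i → s'.EqOff (loop a p).writes s →
      Inv i s' → Inv (i + 1) (p.exec I s')) : Inv (I.size + 1) ((loop a p).exec I s) := by
  suffices h : ∀ m ≤ I.size + 1, Inv m (rounds a (p.exec I) s m) from h _ le_rfl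
  intro m hm
  induction m with
  | zero => exact hput _ _ _ h0
  | succ m ih =>
    refine hput _ _ _ (hstep m _ (by omega) (rounds_counter ..) ?_ (ih (by omega)))
    exact rounds_eqOff List.mem_cons_self
      (fun s => (exec_eqOff p s).mono (List.subset_cons_self _ _)) s m

theorem runs_compileLoop {a : ℕ} {p : Prog} {f : Store → Store} {B : ℕ}
    (hp : ∀ s, ∃ t, Runs I p s (f s) t ∧ t ≤ B)
    (hf : ∀ s, (f s).nat (a, 0, 0, 0) = s.nat (a, 0, 0, 0)) (s : Store) {r m : ℕ}
    (hm : m + r = I.size + 1) :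
    ∃ t, Runs I (compileLoop a p) (rounds a f s m) (rounds a f s (I.size + 1)) t ∧
      t ≤ r * (B + 20) + 10 := by
  have hcounter := rounds_counter a f s
  induction r generalizing m with
  | zero =>
    obtain rfl : m = I.size + 1 := hm
    refine ⟨_, .loop_halt ?_, ?_⟩
    · simp [BExp.Holds, NExp.eval, NExp.var, hcounter]
    · simp [BExp.steps, NExp.steps, NExp.var]
  | succ r ih =>
    obtain ⟨t₁, hbody, ht₁⟩ := hp (rounds a f s m)
    obtain ⟨t₂, hrest, ht₂⟩ := ih (m := m + 1) (by omega)
    have hincr := Runs.setNat (I := I) (f (rounds a f s m)) a (.lit 0) (.lit 0) (.lit 0)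
      (.add (.var a) (.lit 1))
    have hval : (NExp.add (.var a) (.lit 1)).eval I (f (rounds a f s m)) = m + 1 := by
      simp [NExp.eval, NExp.var, hf, hcounter]
    rw [hval] at hincr
    refine ⟨_, .loop_next ?_ (.seq hbody hincr) hrest, ?_⟩
    · simp only [BExp.Holds, NExp.eval, NExp.var, hcounter]
      omega
    · simp only [BExp.steps, NExp.steps, NExp.var]
      rw [add_mul]
      omega

theorem runs_exec {p : Blk} (hwf : p.WellFormed) (s : Store) :
    ∃ t, Runs I p.compile s (p.exec I s) t ∧ t ≤ p.bound.eval I.size := by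
  induction p generalizing s with
  | skip => exact ⟨1, .skip s, by simp [bound]⟩
  | setNat a i j l e => exact ⟨_, .setNat s a i j l e, by simp [bound]⟩
  | setReal a i j l e => exact ⟨_, .setReal s a i j l e, by simp [bound]⟩
  | seq p q hp hq =>
    obtain ⟨t, h1, h2⟩ := hp hwf.1 s
    obtain ⟨t', h1', h2'⟩ := hq hwf.2 (p.exec I s)
    exact ⟨_, .seq h1 h1', by simp only [bound, Polynomial.eval_add]; omega⟩
  | branch b p q hp hq =>
    obtain ⟨t, h1, h2⟩ := hp hwf.1 s
    obtain ⟨t', h1', h2'⟩ := hq hwf.2 s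
    simp only [exec, bound, Polynomial.eval_add, Polynomial.eval_C]
    split_ifs with hb
    · exact ⟨_, .branch_pos hb h1, by omega⟩
    · exact ⟨_, .branch_neg hb h1', by omega⟩
  | loop a p hp =>
    obtain ⟨t, h1, h2⟩ := runs_compileLoop (hp hwf.2)
      (fun s => (exec_eqOff p s a hwf.1 (0, 0, 0)).1) s (zero_add (I.size + 1))
    refine ⟨_, .seq (.setNat s a _ _ _ _) h1, ?_⟩
    simp only [NExp.steps, bound, Polynomial.eval_add, Polynomial.eval_mul, Polynomial.eval_C,
      Polynomial.eval_X, Polynomial.eval_one]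
    omega

end Blk

/-! ## Views of the memory -/

/-- The value of the natural variable `a`. -/
def Store.num (s : Store) (a : ℕ) : ℕ := s.nat (a, 0, 0, 0)

/-- The value of the real variable `a`. -/
def Store.rnum (s : Store) (a : ℕ) : ℝ := s.real (a, 0, 0, 0)

/-- The one-dimensional natural array `a`. -/
def Store.vec (s : Store) (a i : ℕ) : ℕ := s.nat (a, i, 0, 0)

namespace Store

variable (s : Store) (a b i : ℕ)

@[simp] theorem num_putNat (x : Cell) (v : ℕ) :
    (s.putNat x v).num a = if (a, 0, 0, 0) = x then v else s.num a := putNat_nat ..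

@[simp] theorem num_putReal (x : Cell) (v : ℝ) : (s.putReal x v).num a = s.num a := rfl

@[simp] theorem rnum_putNat (x : Cell) (v : ℕ) : (s.putNat x v).rnum a = s.rnum a := rfl

@[simp] theorem rnum_putReal (x : Cell) (v : ℝ) :
    (s.putReal x v).rnum a = if (a, 0, 0, 0) = x then v else s.rnum a := putReal_real ..

@[simp] theorem vec_putReal (x : Cell) (v : ℝ) : (s.putReal x v).vec a = s.vec a := rfl

@[simp] theorem vec_putNat_self (v : ℕ) :
    (s.putNat (a, i, 0, 0) v).vec a = Function.update (s.vec a) i v := by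
  ext j
  simp [vec, Function.update_apply]

variable {a b} in
@[simp] theorem vec_putNat_of_ne (h : a ≠ b) (x : ℕ × ℕ × ℕ) (v : ℕ) :
    (s.putNat (b, x) v).vec a = s.vec a := by
  ext j
  simp [vec, h]

variable {L : List ℕ} {s s' : Store}

theorem EqOff.num (h : s.EqOff L s') (a : ℕ) (ha : a ∉ L := by decide) :
    s.num a = s'.num a := (h a ha _).1

theorem EqOff.rnum (h : s.EqOff L s') (a : ℕ) (ha : a ∉ L := by decide) :
    s.rnum a = s'.rnum a := (h a ha _).2

theorem EqOff.vec (h : s.EqOff L s') (a : ℕ) (ha : a ∉ L := by decide) :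
    s.vec a = s'.vec a := funext fun _ => (h a ha _).1

end Store

attribute [simp] NExp.eval RExp.eval BExp.Holds

@[simp] theorem NExp.eval_var (I : Input) (s : Store) (a : ℕ) :
    (NExp.var a).eval I s = s.num a := rfl

@[simp] theorem NExp.eval_at (I : Input) (s : Store) (a : ℕ) (i : NExp) :
    (NExp.at a i).eval I s = s.vec a (i.eval I s) := rfl

@[simp] theorem RExp.eval_var (I : Input) (s : Store) (a : ℕ) :
    (RExp.var a).eval I s = s.rnum a := rfl

/-- The expression that is positive if the numbers are equal, and zero otherwise. -/
def NExp.isEq (x y : NExp) : NExp := .sub (.lit 1) (.add (.sub x y) (.sub y x))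

@[simp] theorem NExp.eval_isEq (I : Input) (s : Store) (x y : NExp) :
    (NExp.isEq x y).eval I s = if x.eval I s = y.eval I s then 1 else 0 := by
  simp only [isEq, eval]
  split_ifs <;> omega

/-- The test whether a number is positive. -/
def BExp.pos (x : NExp) : BExp := .natLt (.lit 0) x

@[simp] theorem BExp.holds_pos (I : Input) (s : Store) (x : NExp) :
    (BExp.pos x).Holds I s ↔ 0 < x.eval I s := Iff.rfl

/-- The test whether one number is at most another. -/
def BExp.natLe (x y : NExp) : BExp := .neg (.natLt y x)

@[simp] theorem BExp.holds_natLe (I : Input) (s : Store) (x y : NExp) :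
    (BExp.natLe x y).Holds I s ↔ x.eval I s ≤ y.eval I s := not_lt

/-- Implication between tests. -/
def BExp.imp (b b' : BExp) : BExp := .neg (.conj b (.neg b'))

@[simp] theorem BExp.holds_imp (I : Input) (s : Store) (b b' : BExp) :
    (BExp.imp b b').Holds I s ↔ (b.Holds I s → b'.Holds I s) := by
  simp [imp]

namespace Blk

section Exec

variable (I : Input) (s : Store)

@[simp] theorem exec_setNat (a : ℕ) (i j l e : NExp) : (setNat a i j l e).exec I s =
    s.putNat (a, i.eval I s, j.eval I s, l.eval I s) (e.eval I s) := rfl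

@[simp] theorem exec_setAt (a : ℕ) (i e : NExp) :
    (setAt a i e).exec I s = s.putNat (a, i.eval I s, 0, 0) (e.eval I s) := rfl

@[simp] theorem exec_setReal (a : ℕ) (i j l : NExp) (e : RExp) : (setReal a i j l e).exec I s =
    s.putReal (a, i.eval I s, j.eval I s, l.eval I s) (e.eval I s) := rfl

@[simp] theorem exec_letNat (a : ℕ) (e : NExp) :
    (letNat a e).exec I s = s.putNat (a, 0, 0, 0) (e.eval I s) := rfl

@[simp] theorem exec_letReal (a : ℕ) (e : RExp) :
    (letReal a e).exec I s = s.putReal (a, 0, 0, 0) (e.eval I s) := rfl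

@[simp] theorem exec_seq (p q : Blk) : (p ;; q).exec I s = q.exec I (p.exec I s) := rfl

variable {s}

theorem exec_branch_pos {b : BExp} (p q : Blk) (h : b.Holds I s) :
    (branch b p q).exec I s = p.exec I s := if_pos h

theorem exec_branch_neg {b : BExp} (p q : Blk) (h : ¬ b.Holds I s) :
    (branch b p q).exec I s = q.exec I s := if_neg h

end Exec

variable {I : Input}

/-- The loop in which the counter `a` runs through the numbers `1, …, n`. -/
def forEach (a : ℕ) (p : Blk) : Blk := loop a (branch (.pos (.var a)) p skip)

theorem exec_forEach_invariant {a : ℕ} {p : Blk} {s : Store} (Inv : ℕ → Store → Prop)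
    (h1 : Inv 1 s) (hput : ∀ t s' v, Inv t s' → Inv t (s'.putNat (a, 0, 0, 0) v))
    (hstep : ∀ t s', t ∈ Set.Icc 1 I.size → s'.num a = t → s'.EqOff (forEach a p).writes s →
      Inv t s' → Inv (t + 1) (p.exec I s')) : Inv (I.size + 1) ((forEach a p).exec I s) := by
  have key := exec_loop_invariant (I := I) (a := a) (p := branch (.pos (.var a)) p skip)
    (fun i => Inv (max i 1)) h1 (fun i => hput _) fun i s' hi hcount hoff h => ?_
  · simpa only [forEach, Nat.le_add_left, max_eq_left] using key
  · replace hcount : s'.num a = i := hcount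
    rcases i.eq_zero_or_pos with rfl | hpos
    · rwa [exec_branch_neg _ _ _ (by simp [hcount])]
    · rw [max_eq_left (by omega)] at h ⊢
      rw [exec_branch_pos _ _ _ (by simpa [hcount] using hpos)]
      exact hstep i s' ⟨hpos, hi⟩ hcount hoff h

theorem exec_loop_loop_invariant {a b : ℕ} {p : Blk} {s : Store}
    (hab : a ∉ (loop b p).writes) (Inv : Set (ℕ × ℕ) → Store → Prop) (h0 : Inv ∅ s)
    (hputa : ∀ T s' v, Inv T s' → Inv T (s'.putNat (a, 0, 0, 0) v))
    (hputb : ∀ T s' v, Inv T s' → Inv T (s'.putNat (b, 0, 0, 0) v))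
    (hstep : ∀ i j T s', i ≤ I.size → j ≤ I.size → s'.num a = i → s'.num b = j →
      s'.EqOff (loop a (loop b p)).writes s → (∀ i' < i, ∀ j' ≤ I.size, (i', j') ∈ T) →
      Inv T s' → Inv (insert (i, j) T) (p.exec I s')) :
    Inv (Set.Iic I.size ×ˢ Set.Iic I.size) ((loop a (loop b p)).exec I s) := by
  set n := I.size
  have outer := exec_loop_invariant (I := I) (p := loop b p) (fun i => Inv (Set.Iio i ×ˢ Set.Iic n))
    (by simpa using h0) (fun i => hputa _) fun i s₁ hi ha hoff₁ h₁ => ?_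
  · rwa [show Set.Iio (n + 1) = Set.Iic n from Set.Iio_succ_eq_Iic n] at outer
  have inner := exec_loop_invariant (I := I) (p := p)
    (fun j => Inv (Set.Iio i ×ˢ Set.Iic n ∪ {i} ×ˢ Set.Iio j)) (by simpa using h₁)
    (fun j => hputb _) fun j s₂ hj hb hoff₂ h₂ => ?_
  · convert inner using 1
    ext x
    simp only [Set.mem_prod, Set.mem_Iio, Set.mem_Iic, Set.mem_union, Set.mem_singleton_iff]
    omega
  have ha₂ : s₂.num a = i := (hoff₂.num a hab).trans ha
  convert hstep i j _ s₂ hi hj ha₂ hb ((hoff₂.mono (List.subset_cons_self _ _)).trans hoff₁)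
    (fun i' hi' j' hj' => Or.inl ⟨hi', hj'⟩) h₂ using 1
  ext x
  simp only [Set.mem_prod, Set.mem_Iio, Set.mem_Iic, Set.mem_union, Set.mem_singleton_iff,
    Set.mem_insert_iff, Prod.ext_iff]
  omega

end Blk

/-! ## The memory layout -/

namespace Arr

/-! The points are listed in the order in which Prim's algorithm finds them; `parent`, `firstChild`,
`label` etc. refer to positions in this list. The position `0` stands for no position. -/

/-- The number of the cluster of a point. -/
@[simp] abbrev output : ℕ := 0
/-- The point at a position. -/
@[simp] abbrev point : ℕ := 1
/-- The parent of a position. -/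
@[simp] abbrev parent : ℕ := 2
/-- Whether a point has been found. -/
@[simp] abbrev mark : ℕ := 3
/-- Whether the first position is an ancestor of the second. -/
@[simp] abbrev ancestor : ℕ := 4
/-- The first child of a position. -/
@[simp] abbrev firstChild : ℕ := 5
/-- Table of the dynamic program: whether an entry is feasible. -/
@[simp] abbrev tableFeas : ℕ := 6
/-- Table of the dynamic program: the label of the position. -/
@[simp] abbrev tableLabel : ℕ := 7
/-- Table of the dynamic program: the number of centers below the position. -/
@[simp] abbrev tableBelow : ℕ := 8
/-- The number of centers that remain to be placed below a position. -/
@[simp] abbrev remaining : ℕ := 9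
/-- The label of a position. -/
@[simp] abbrev label : ℕ := 10
/-- The number of centers before a position. -/
@[simp] abbrev rank : ℕ := 11
/-- Whether a search has found a candidate. -/
@[simp] abbrev found : ℕ := 12
/-- The first component of the best candidate. -/
@[simp] abbrev bestRow : ℕ := 13
/-- The second component of the best candidate. -/
@[simp] abbrev bestCol : ℕ := 14
/-- The first component of the current candidate. -/
@[simp] abbrev row : ℕ := 15
/-- The second component of the current candidate. -/
@[simp] abbrev col : ℕ := 16
/-- The first loop counter. -/
@[simp] abbrev outer : ℕ := 17
/-- The second loop counter. -/
@[simp] abbrev inner : ℕ := 18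
/-- The third loop counter. -/
@[simp] abbrev innermost : ℕ := 19
/-- The position whose row of the table is computed. -/
@[simp] abbrev node : ℕ := 20
/-- The real variable for the value of the null entries of the table. -/
@[simp] abbrev nullValue : ℕ := 21
/-- Table of the dynamic program: the value of an entry. -/
@[simp] abbrev tableValue : ℕ := 22
/-- The real variable for the cost of the current candidate. -/
@[simp] abbrev current : ℕ := 23
/-- The real variable for the cost of the best candidate. -/
@[simp] abbrev best : ℕ := 24

end Arr

open Arr

/-! ## Search for a best pair -/

namespace IsBest

variable {ι : Type*} {S : Set ι} {F : ι → ℝ} {found : Prop} {x y : ι} {v : ℝ}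

theorem empty (hf : ¬ found) : IsBest ∅ F found x v :=
  ⟨by simp, fun h => absurd h hf, fun h => absurd h hf, by simp⟩

theorem insert_of_le (h : IsBest S F found x v) (hf : found) (hle : v ≤ F y) :
    IsBest (insert y S) F found x v :=
  ⟨fun _ _ => hf, fun hf => Or.inr (h.mem hf), h.val_eq, fun z hz => hz.elim (· ▸ hle) (h.le z)⟩

theorem insert_self (h : IsBest S F found x v) {found' : Prop} (hf : found')
    (hle : found → F y ≤ v) : IsBest (insert y S) F found' y (F y) :=
  ⟨fun _ _ => hf, fun _ => Or.inl rfl, fun _ => rfl, fun z hz => hz.elim (fun h => h ▸ le_rfl)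
    fun hz => (hle (h.found_of_mem z hz)).trans (h.le z hz)⟩

end IsBest

namespace Blk

/-- The names of the arrays that a search changes. -/
def searchVars : List ℕ := [found, bestRow, bestCol, row, col, current, best]

/-- Makes the current candidate the best one. -/
def record : Blk :=
  letNat found (.lit 1) ;; letNat bestRow (.var row) ;; letNat bestCol (.var col) ;;
    letReal best (.var current)

/-- Replaces the best candidate by the current one, computing its cost, if the latter is better. -/
def compare (cost : Blk) : Blk :=
  cost ;; branch (.imp (.pos (.var found)) (.realLt (.var current) (.var best))) record skip

/-- Search for a pair `(row, col)` that satisfies a test and has the smallest possible cost. The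
program `cost` leaves the cost of the pair in the variable `current`. -/
def search (test : BExp) (cost : Blk) : Blk :=
  letNat found (.lit 0) ;; loop row (loop col (branch test (compare cost) skip))

/-- The state of a search after the candidates in `S` have been considered. -/
def SearchState (S : Set (ℕ × ℕ)) (F : ℕ × ℕ → ℝ) (s : Store) : Prop :=
  IsBest S F (0 < s.num found) (s.num bestRow, s.num bestCol) (s.rnum best)

variable {I : Input} {S : Set (ℕ × ℕ)} {F : ℕ × ℕ → ℝ} {s : Store}

theorem SearchState.exec_compare {cost : Blk} {i j : ℕ} (hcost : cost.writes ⊆ [current])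
    (hi : s.num row = i) (hj : s.num col = j) (hF : (cost.exec I s).rnum current = F (i, j))
    (h : SearchState S F s) :
    SearchState (insert (i, j) S) F ((compare cost).exec I s) := by
  have hoff := (exec_eqOff (I := I) cost s).mono hcost
  rw [compare, exec_seq]
  set s' := cost.exec I s
  have h' : SearchState S F s' := by
    rwa [SearchState, hoff.num found, hoff.num bestRow, hoff.num bestCol, hoff.rnum best]
  have hi' : s'.num row = i := (hoff.num row).trans hi
  have hj' : s'.num col = j := (hoff.num col).trans hj
  by_cases hlt : 0 < s'.num found → s'.rnum current < s'.rnum best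
  · rw [exec_branch_pos _ _ _ (by simpa using hlt)]
    have := h'.insert_self (found' := 0 < 1) one_pos fun hf => (hF ▸ hlt hf).le
    simpa [record, SearchState, hF, hi', hj'] using this
  · rw [exec_branch_neg _ _ _ (by simpa using hlt)]
    push Not at hlt
    exact h'.insert_of_le hlt.1 (hF ▸ hlt.2)

theorem exec_search {test : BExp} {cost : Blk} (hcost : cost.writes ⊆ [current])
    (hS : S ⊆ Set.Iic I.size ×ˢ Set.Iic I.size)
    (htest : ∀ s' i j, s'.EqOff searchVars s → s'.num row = i → s'.num col = j →
      (test.Holds I s' ↔ (i, j) ∈ S))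
    (hF : ∀ s' i j, s'.EqOff searchVars s → s'.num row = i → s'.num col = j → (i, j) ∈ S →
      (cost.exec I s').rnum current = F (i, j)) :
    SearchState S F ((search test cost).exec I s) := by
  have hsub : (search test cost).writes ⊆ searchVars := by
    have : cost.writes ⊆ searchVars := List.Subset.trans hcost (by decide)
    simp_all [search, compare, record, writes, letNat, letReal, searchVars]
  have hnotin : row ∉ (loop col (branch test (compare cost) skip)).writes := fun h => by
    have := @hcost row
    simp_all [compare, record, writes, letNat, letReal]
  have hstart : ((letNat found (.lit 0)).exec I s).EqOff searchVars s :=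
    Store.putNat_eqOff (by decide) _ _ _
  rw [search, exec_seq, ← Set.inter_eq_self_of_subset_right hS]
  refine exec_loop_loop_invariant hnotin (fun T => SearchState (T ∩ S) F) ?_ ?_ ?_ ?_
  · rw [Set.empty_inter]
    exact .empty (by simp)
  · exact fun T s' v h => by simpa [SearchState] using h
  · exact fun T s' v h => by simpa [SearchState] using h
  · intro i j T s' _ _ hi hj hoff _ h
    have hoff' := (hoff.mono (List.Subset.trans (List.subset_cons_self _ _) hsub)).trans hstart
    by_cases hmem : (i, j) ∈ S
    · rw [exec_branch_pos _ _ _ ((htest s' i j hoff' hi hj).2 hmem),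
        Set.insert_inter_of_mem hmem]
      exact h.exec_compare hcost hi hj (hF s' i j hoff' hi hj hmem)
    · rw [exec_branch_neg _ _ _ (mt (htest s' i j hoff' hi hj).1 hmem),
        Set.insert_inter_of_notMem hmem]
      exact h

end Blk

/-! ## Prim's algorithm -/

/-- The state of Prim's algorithm for the points `v < n` with distances `D` when the positions
before `t` are filled: `pt r` is the point at the position `r`, and `par r` is its parent. -/
structure IsPrimRun (n : ℕ) (D : ℕ → ℕ → ℝ) (t : ℕ) (pt par : ℕ → ℕ) : Prop where
  pt_lt : ∀ r ∈ Set.Ico 1 t, pt r < n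
  injOn : Set.InjOn pt (Set.Ico 1 t)
  par_lt : ∀ r ∈ Set.Ico 1 t, par r < r
  par_ne_zero : ∀ r ∈ Set.Ico 2 t, par r ≠ 0
  par_eq_zero : ∀ r ∉ Set.Ico 1 t, par r = 0
  greedy : ∀ r ∈ Set.Ico 2 t, ∀ a ∈ Set.Ico 1 r, ∀ v < n, v ∉ pt '' Set.Ico 1 r →
    D (pt (par r)) (pt r) ≤ D (pt a) v

/-- The edges that may be added to the tree: they lead from a filled position to an unused point.
The edge to the first point starts at the position `0`. -/
def primEdges (n t : ℕ) (pt : ℕ → ℕ) : Set (ℕ × ℕ) :=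
  {x | x.1 < t ∧ (x.1 < 1 → t < 2) ∧ x.2 < n ∧ x.2 ∉ pt '' Set.Ico 1 t}

theorem update_image_Ico {r t : ℕ} (f : ℕ → ℕ) (v : ℕ) (hr : r ≤ t) :
    Function.update f t v '' Set.Ico 1 r = f '' Set.Ico 1 r :=
  Set.image_congr fun _ ha => Function.update_of_ne (ha.2.trans_le hr).ne _ _

namespace IsPrimRun

variable {n t : ℕ} {D : ℕ → ℕ → ℝ} {pt par : ℕ → ℕ}

theorem init : IsPrimRun n D 1 pt 0 := by
  constructor <;> simp +contextual [Set.InjOn]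

theorem primEdges_nonempty (ht : t ∈ Set.Icc 1 n) : (primEdges n t pt).Nonempty := by
  have hcard : ((Finset.Ico 1 t).image pt).card < (Finset.range n).card := by
    grw [Finset.card_image_le, Nat.card_Ico, Finset.card_range]
    have := ht.1
    have := ht.2
    omega
  obtain ⟨v, hv, hv'⟩ := Finset.exists_mem_notMem_of_card_lt_card hcard
  have ht1 := ht.1
  refine ⟨(t - 1, v), ?_, fun h => ?_, Finset.mem_range.1 hv, ?_⟩
  · simp only; omega
  · simp only at h; omega
  · simpa using hv'

theorem step {x : ℕ × ℕ} (h : IsPrimRun n D t pt par) (ht : 1 ≤ t) (hx : x ∈ primEdges n t pt)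
    (hmin : IsMinOn (fun y => D (pt y.1) y.2) (primEdges n t pt) x) :
    IsPrimRun n D (t + 1) (Function.update pt t x.2) (Function.update par t x.1) := by
  obtain ⟨hxt, hx0, hxn, hxu⟩ := hx
  have hlt {r : ℕ} (hr : r < t) : Function.update pt t x.2 r = pt r :=
    Function.update_of_ne hr.ne _ _
  have hIco : Set.Ico 1 (t + 1) = insert t (Set.Ico 1 t) :=
    (Set.insert_Ico_right_eq_Ico_add_one ht).symm
  constructor
  · rw [hIco, Set.forall_mem_insert]
    exact ⟨by simpa using hxn, fun r hr => by rw [hlt hr.2]; exact h.pt_lt r hr⟩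
  · rw [hIco, Set.injOn_insert (by simp), update_image_Ico _ _ le_rfl]
    exact ⟨h.injOn.congr fun r hr => (hlt hr.2).symm, by simpa using hxu⟩
  · rw [hIco, Set.forall_mem_insert]
    exact ⟨by simpa using hxt, fun r hr => by
      rw [Function.update_of_ne hr.2.ne]; exact h.par_lt r hr⟩
  · intro r hr
    rcases Nat.lt_succ_iff_lt_or_eq.1 hr.2 with hrt | rfl
    · rw [Function.update_of_ne hrt.ne]
      exact h.par_ne_zero r ⟨hr.1, hrt⟩
    · rw [Function.update_self]
      have := hr.1
      omega
  · intro r hr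
    have hrt : r ∉ insert t (Set.Ico 1 t) := hIco ▸ hr
    rw [Set.mem_insert_iff, not_or] at hrt
    rw [Function.update_of_ne hrt.1]
    exact h.par_eq_zero r hrt.2
  · intro r hr a ha v hv hvr
    rw [update_image_Ico _ _ (Nat.lt_succ_iff.1 hr.2)] at hvr
    have har : a < t := ha.2.trans_le (Nat.lt_succ_iff.1 hr.2)
    rw [hlt har]
    rcases Nat.lt_succ_iff_lt_or_eq.1 hr.2 with hrt | rfl
    · have hpar := h.par_lt r ⟨by have := hr.1; omega, hrt⟩
      rw [Function.update_of_ne hrt.ne, hlt hrt, hlt (hpar.trans hrt)]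
      exact h.greedy r ⟨hr.1, hrt⟩ a ha v hv hvr
    · rw [Function.update_self, Function.update_self, hlt hxt]
      exact hmin (a := (a, v)) ⟨har, fun h0 => by have := ha.1; simp only at h0; omega, hv, hvr⟩

theorem isRootedTree (h : IsPrimRun n D (n + 1) pt par) : IsRootedTree n par where
  par_lt t ht := by
    by_cases hmem : t ∈ Set.Ico 1 (n + 1)
    · exact h.par_lt t hmem
    · rw [h.par_eq_zero t hmem]
      omega
  par_ne_zero t ht htn := h.par_ne_zero t ⟨ht, by omega⟩

theorem isGreedyTree (h : IsPrimRun n D (n + 1) pt par) :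
    IsGreedyTree n (fun a b => D (pt a) (pt b)) par := by
  intro t a b ha hat htb hbn
  refine h.greedy t ⟨by omega, by omega⟩ a ⟨by omega, hat⟩ (pt b)
    (h.pt_lt b ⟨by omega, by omega⟩) ?_
  rintro ⟨r, ⟨hr1, hrt⟩, hr⟩
  have := h.injOn ⟨hr1, by omega⟩ ⟨by omega, by omega⟩ hr
  omega

end IsPrimRun

namespace Blk

/-- The search for a shortest edge in `primEdges n t pt`, where `t` is the counter `outer`. -/
def shortestEdge : Blk :=
  search
    (.conj (.natLt (.var row) (.var outer))
      (.conj (.imp (.natLt (.var row) (.lit 1)) (.natLt (.var outer) (.lit 2)))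
        (.conj (.natLt (.var col) .size) (.natLt (.at mark (.var col)) (.lit 1)))))
    (letReal current (.dist (.at point (.var row)) (.var col)))

/-- Prim's algorithm. -/
def prim : Blk :=
  forEach outer (shortestEdge ;;
    setAt point (.var outer) (.var bestCol) ;; setAt parent (.var outer) (.var bestRow) ;;
    setAt mark (.var bestCol) (.lit 1))

variable {I : Input} {s : Store} {t : ℕ}

theorem exec_shortestEdge (ht : s.num outer = t) (htn : t ≤ I.size)
    (hmark : ∀ v, s.vec mark v = 0 ↔ v ∉ s.vec point '' Set.Ico 1 t) :
    SearchState (primEdges I.size t (s.vec point)) (fun x => I.dist (s.vec point x.1) x.2)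
      (shortestEdge.exec I s) := by
  refine exec_search (by decide) ?_ ?_ ?_
  · rintro x ⟨hxt, -, hxn, -⟩
    exact ⟨(hxt.trans_le htn).le, hxn.le⟩
  · intro s' i j hoff hi hj
    have hu : s'.vec mark j = 0 ↔ j ∉ s.vec point '' Set.Ico 1 t := by
      rw [hoff.vec mark, hmark]
    have ht' : s'.num outer = t := (hoff.num outer).trans ht
    simp only [BExp.Holds, BExp.holds_imp, NExp.eval, NExp.eval_var, NExp.eval_at, hi, hj, ht',
      Nat.lt_one_iff, hu, primEdges, Set.mem_ofPred_eq]
  · intro s' i j hoff hi hj _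
    simp [hoff.vec point, hi, hj]

theorem exec_prim (hpar : s.vec parent = 0) (hmark : s.vec mark = 0) :
    IsPrimRun I.size I.dist (I.size + 1) ((prim.exec I s).vec point)
      ((prim.exec I s).vec parent) := by
  refine (exec_forEach_invariant (fun t s' =>
    IsPrimRun I.size I.dist t (s'.vec point) (s'.vec parent) ∧
    ∀ v, s'.vec mark v = 0 ↔ v ∉ s'.vec point '' Set.Ico 1 t) ?_ ?_ ?_).1
  · exact ⟨hpar ▸ .init, by simp [hmark]⟩
  · exact fun t s' v h => by simpa using h
  · rintro t s' ht hcount - ⟨hrun, hm⟩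
    have hbest := exec_shortestEdge (I := I) hcount ht.2 hm
    have hoff := exec_eqOff (I := I) shortestEdge s'
    obtain ⟨y, hy⟩ := IsPrimRun.primEdges_nonempty (pt := s'.vec point) ht
    have hmem := hbest.mem (hbest.found_of_mem y hy)
    have hmin := fun z hz => (hbest.val_eq (hbest.found_of_mem y hy)).symm.trans_le (hbest.le z hz)
    simp only [exec_seq]
    generalize shortestEdge.exec I s' = s₁ at *
    have hcount₁ : s₁.num outer = t := (hoff.num outer).trans hcount
    have hrow := hrun.step ht.1 hmem hmin
    simp only [← hoff.vec point, ← hoff.vec parent, ← hoff.vec mark] at hrow hm hmem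
    generalize hs₂ : (setAt mark _ _).exec I _ = s₂
    have hpoint : s₂.vec point = Function.update (s₁.vec point) t (s₁.num bestCol) := by
      simp [← hs₂, hcount₁]
    refine ⟨by simpa [hpoint, ← hs₂, hcount₁] using hrow, fun v => ?_⟩
    rw [hpoint, ← Set.insert_Ico_right_eq_Ico_add_one ht.1, Set.image_insert_eq,
      Function.update_self, update_image_Ico _ _ le_rfl, Set.mem_insert_iff, not_or, ← hm]
    by_cases hv : v = s₁.num bestCol <;> simp_all [← hs₂]

end Blk

/-! ## The dynamic program -/

/-- The memory holds the points `pt t` at the positions `t ≤ n`, the parents `par t` of the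
positions, and the matrix of the relation `InSubtree par`. -/
structure Store.HoldsTree (s : Store) (n : ℕ) (pt par : ℕ → ℕ) : Prop where
  point : s.vec point = pt
  parent : s.vec parent = par
  ancestor : ∀ t ≤ n, ∀ x ≤ n, (0 < s.nat (ancestor, t, x, 0) ↔ InSubtree par t x)

theorem Store.HoldsTree.of_eqOff {s s' : Store} {n : ℕ} {pt par : ℕ → ℕ} {L : List ℕ}
    (h : s'.HoldsTree n pt par) (hoff : s.EqOff L s')
    (hL : ∀ a ∈ [Arr.point, Arr.parent, Arr.ancestor], a ∉ L := by decide) :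
    s.HoldsTree n pt par := by
  refine ⟨(hoff.vec _ (hL _ (by simp))).trans h.point,
    (hoff.vec _ (hL _ (by simp))).trans h.parent, fun t ht x hx => ?_⟩
  rw [(hoff _ (hL Arr.ancestor (by simp)) _).1]
  exact h.ancestor t ht x hx

namespace Blk

/-- Computes the entry `(inner, outer)` of the matrix of the relation `InSubtree`. -/
def ancestorEntry : Blk :=
  .setNat ancestor (.var inner) (.var outer) (.lit 0) (.add (.isEq (.var inner) (.var outer))
    (.get ancestor (.var inner) (.at parent (.var outer)) (.lit 0)))

/-- Computes the matrix of the relation `InSubtree`, one column at a time. -/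
def ancestors : Blk := loop outer (loop inner ancestorEntry)

variable {I : Input} {s : Store} {pt par : ℕ → ℕ}

theorem exec_ancestorEntry {x t : ℕ} (hx : s.num outer = x) (ht : s.num inner = t)
    (t' x' : ℕ) : (ancestorEntry.exec I s).nat (ancestor, t', x', 0) =
      if t' = t ∧ x' = x then (if t = x then 1 else 0) + s.nat (ancestor, t, s.vec parent x, 0)
      else s.nat (ancestor, t', x', 0) := by
  simp [ancestorEntry, hx, ht]

theorem exec_ancestors (h : IsRootedTree I.size par) (hpar : s.vec parent = par)
    (hpar0 : par 0 = 0) (hzero : ∀ x, s.nat (ancestor, x) = 0) :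
    (ancestors.exec I s).HoldsTree I.size (s.vec point) par := by
  have hoff := exec_eqOff (I := I) ancestors s
  refine ⟨hoff.vec point, (hoff.vec parent).trans hpar, ?_⟩
  suffices key : (∀ t x, 0 < (ancestors.exec I s).nat (ancestor, t, x, 0) → InSubtree par t x) ∧
      ∀ x t, (x, t) ∈ Set.Iic I.size ×ˢ Set.Iic I.size → InSubtree par t x →
        0 < (ancestors.exec I s).nat (ancestor, t, x, 0) from
    fun t ht x hx => ⟨key.1 t x, key.2 x t ⟨hx, ht⟩⟩
  refine exec_loop_loop_invariant (by decide)
    (fun T s' => (∀ t x, 0 < s'.nat (ancestor, t, x, 0) → InSubtree par t x) ∧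
      ∀ x t, (x, t) ∈ T → InSubtree par t x → 0 < s'.nat (ancestor, t, x, 0))
    (by simp [hzero]) (fun T s' v h => by simpa using h) (fun T s' v h => by simpa using h)
    fun x t T s' _ ht hx' ht' hoff hT ⟨hsound, hcomplete⟩ => ?_
  have hparx : s'.vec parent x = par x := by rw [hoff.vec parent, hpar]
  simp only [exec_ancestorEntry hx' ht', hparx]
  refine ⟨fun t' x' hpos => ?_, fun x' t' hmem hsub => ?_⟩ <;> split_ifs at * with hcell heq
  · exact hcell.1.trans (heq.trans hcell.2.symm) ▸ .refl _
  · rw [hcell.1, hcell.2]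
    have hup := hsound t (par x) (by simpa using hpos)
    rcases eq_or_ne x 0 with rfl | hx0
    · rwa [hpar0] at hup
    · exact inSubtree_of_par hx0 hup
  · exact hsound t' x' hpos
  · omega
  · rw [hcell.1, hcell.2] at hsub
    have hx0 : x ≠ 0 := fun hx0 => heq (by rwa [hx0, inSubtree_zero_iff, ← hx0] at hsub)
    rw [zero_add]
    exact hcomplete _ _ (hT _ (h.par_lt x hx0) t ht) (((inSubtree_iff hx0).1 hsub).resolve_left heq)
  · refine hcomplete x' t' (hmem.resolve_left fun heq => hcell ?_) hsub
    exact (Prod.ext_iff.1 heq).symm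

end Blk

/-! ## Filling the table -/

namespace Table

variable {n : ℕ} {par : ℕ → ℕ} {op : ℝ → ℝ → ℝ} {own : ℕ → ℕ → ℝ} {B B' : Table} {t j c : ℕ}

/-- The tables have the same entry `(t, j, c)`. -/
structure AgreeAt (B B' : Table) (t j c : ℕ) : Prop where
  feas : B.feas t j c ↔ B'.feas t j c
  val : B.val t j c = B'.val t j c
  label : B.label t j c = B'.label t j c
  below : B.below t j c = B'.below t j c

theorem AgreeAt.refl (B : Table) (t j c : ℕ) : B.AgreeAt B t j c := ⟨Iff.rfl, rfl, rfl, rfl⟩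

theorem AgreeAt.symm (h : B.AgreeAt B' t j c) : B'.AgreeAt B t j c :=
  ⟨h.feas.symm, h.val.symm, h.label.symm, h.below.symm⟩

theorem AgreeAt.trans {B'' : Table} (h : B.AgreeAt B' t j c) (h' : B'.AgreeAt B'' t j c) :
    B.AgreeAt B'' t j c :=
  ⟨h.feas.trans h'.feas, h.val.trans h'.val, h.label.trans h'.label, h.below.trans h'.below⟩

theorem Null.congr {e : ℝ} (hnull : B.Null n e) (h : ∀ j c, B.AgreeAt B' 0 j c) : B'.Null n e :=
  ⟨fun j hj c hc => (h j c).feas.symm.trans (hnull.feas j hj c hc),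
    fun c hc => (h 0 c).val.symm.trans (hnull.val c hc)⟩

theorem head_eq_zero_or_le (n : ℕ) (par : ℕ → ℕ) (t p : ℕ) :
    head n par t p = 0 ∨ t ≤ head n par t p :=
  (Nat.eq_zero_or_pos _).imp_right fun h => (Nat.sInf_mem (Nat.nonempty_of_pos_sInf h)).1

theorem BestEntry.congr {B₁ B₁' : Table} (hbest : B.BestEntry n par op own B' t j c)
    (h : ∀ r, r = 0 ∨ t < r → ∀ j c, B.AgreeAt B₁ r j c) (h' : B'.AgreeAt B₁' t j c) :
    B₁.BestEntry n par op own B₁' t j c := by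
  have hagree (p : ℕ) := h _ (head_eq_zero_or_le n par (t + 1) p)
  have hchoices : B.choices n par t j c = B₁.choices n par t j c := by
    simp only [choices, (hagree _ _ _).feas]
  have hcost : B.choiceCost n par op own t j c = B₁.choiceCost n par op own t j c := by
    funext x
    simp only [choiceCost, (hagree _ _ _).val]
  rwa [BestEntry, ← hchoices, ← hcost, ← h'.feas, ← h'.val, ← h'.label, ← h'.below]

end Table

/-- The table of the dynamic program in the memory. -/
def Store.table (s : Store) : Table where
  feas t j c := 0 < s.nat (tableFeas, t, j, c)
  val t j c := s.real (tableValue, t, j, c)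
  label t j c := s.nat (tableLabel, t, j, c)
  below t j c := s.nat (tableBelow, t, j, c)

theorem Store.EqOff.table {L : List ℕ} {s s' : Store} (h : s.EqOff L s')
    (hL : ∀ a ∈ [tableFeas, tableValue, tableLabel, tableBelow], a ∉ L := by decide) :
    s.table = s'.table := by
  simp only [Store.table, h _ (hL tableFeas (by simp)), h _ (hL tableValue (by simp)),
    h _ (hL tableLabel (by simp)), h _ (hL tableBelow (by simp))]

/-- The contribution of the point at the position `t` to the cost if its center is at the
position `c`; compare `CostData.own`. -/
noncomputable def Input.own (I : Input) (pt : ℕ → ℕ) (t c : ℕ) : ℝ :=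
  if c = t then I.kind.op (I.connCost (pt t) (pt c)) (I.centerCost (pt t))
  else I.connCost (pt t) (pt c)

/-- A value for the entries of the table that stand for no points. It is neutral for sums, and a
lower bound for maxima. -/
structure Input.IsNullValue (I : Input) (e : ℝ) : Prop where
  total : I.kind = .total → e = 0
  bottleneck : I.kind = .bottleneck → ∀ u ≤ I.size, ∀ c ≤ I.size, e ≤ I.connCost u c

/-- The test whether the costs are combined by taking the maximum. -/
def BExp.bottleneck : BExp := .pos .kind

@[simp] theorem BExp.holds_bottleneck (I : Input) (s : Store) :
    BExp.bottleneck.Holds I s ↔ I.kind = .bottleneck := by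
  cases h : I.kind <;> simp [bottleneck, h]

namespace Blk

/-- Computes a number `e` such that `Input.IsNullValue I e`. -/
def nullCost : Blk :=
  loop outer (loop inner (branch
    (.conj .bottleneck (.realLt (.connCost (.var outer) (.var inner)) (.var nullValue)))
    (letReal nullValue (.connCost (.var outer) (.var inner))) skip))

/-- Fills the row `0` of the table. -/
def nullRow : Blk :=
  loop outer (loop inner (
    .setNat tableFeas (.lit 0) (.var outer) (.var inner) (.isEq (.var outer) (.lit 0)) ;;
    .setReal tableValue (.lit 0) (.var outer) (.var inner) (.var nullValue)))

variable {I : Input} {s : Store}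

theorem exec_nullCost (h : s.rnum nullValue = 0) :
    I.IsNullValue ((nullCost.exec I s).rnum nullValue) := by
  suffices key : (I.kind = .total → (nullCost.exec I s).rnum nullValue = 0) ∧
      (I.kind = .bottleneck → ∀ x ∈ Set.Iic I.size ×ˢ Set.Iic I.size,
        (nullCost.exec I s).rnum nullValue ≤ I.connCost x.1 x.2) from
    ⟨key.1, fun hk u hu c hc => key.2 hk (u, c) ⟨hu, hc⟩⟩
  refine exec_loop_loop_invariant (by decide) (fun T s' =>
    (I.kind = .total → s'.rnum nullValue = 0) ∧
      (I.kind = .bottleneck → ∀ x ∈ T, s'.rnum nullValue ≤ I.connCost x.1 x.2))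
    (by simp [h]) (fun T s' v h => by simpa using h) (fun T s' v h => by simpa using h)
    fun u c T s' _ _ hu hc _ _ ⟨htotal, hbottleneck⟩ => ?_
  by_cases hb : I.kind = .bottleneck ∧ I.connCost u c < s'.rnum nullValue
  · rw [exec_branch_pos _ _ _ (by simpa [hu, hc] using hb)]
    refine ⟨fun hk => by simp [hk] at hb, fun hk => Set.forall_mem_insert.2 ⟨?_, fun x hx => ?_⟩⟩
    · simp [hu, hc]
    · simpa [hu, hc] using hb.2.le.trans (hbottleneck hk x hx)
  · rw [exec_branch_neg _ _ _ (by simpa [hu, hc] using hb)]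
    exact ⟨htotal, fun hk => Set.forall_mem_insert.2
      ⟨not_lt.1 fun hlt => hb ⟨hk, hlt⟩, hbottleneck hk⟩⟩

theorem exec_nullRow : (nullRow.exec I s).table.Null I.size (s.rnum nullValue) := by
  suffices key : ∀ x ∈ Set.Iic I.size ×ˢ Set.Iic I.size,
      ((nullRow.exec I s).table.feas 0 x.1 x.2 ↔ x.1 = 0) ∧
        (nullRow.exec I s).table.val 0 x.1 x.2 = s.rnum nullValue from
    ⟨fun j hj c hc => (key (j, c) ⟨hj, hc⟩).1, fun c hc => (key (0, c) ⟨I.size.zero_le, hc⟩).2⟩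
  refine exec_loop_loop_invariant (by decide) (fun T s' => ∀ x ∈ T,
    (s'.table.feas 0 x.1 x.2 ↔ x.1 = 0) ∧ s'.table.val 0 x.1 x.2 = s.rnum nullValue)
    (by simp) (fun T s' v h => by simpa [Store.table] using h)
    (fun T s' v h => by simpa [Store.table] using h) fun j c T s' _ _ hj hc hoff _ hinv => ?_
  have hval := hoff.rnum nullValue
  rintro ⟨j', c'⟩ hx
  by_cases heq : j' = j ∧ c' = c
  · by_cases hj0 : j = 0 <;> simp [Store.table, hj, hc, hval, heq, hj0]
  · have hx' := hinv _ (hx.resolve_left fun h => heq (Prod.ext_iff.1 h))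
    simp only [Store.table] at hx'
    simpa [Store.table, hj, hc, heq] using hx'

end Blk

@[simp] theorem Store.putReal_rnum (s : Store) (a : ℕ) :
    s.putReal (a, 0, 0, 0) (s.rnum a) = s := by
  rw [Store.putReal, Store.rnum, Function.update_eq_self]

/-- The number of centers that remain for the later siblings of the position `node`; compare
`laterCount`. -/
def NExp.later (total node label below : NExp) : NExp :=
  .sub total (.add (.isEq label node) below)

@[simp] theorem NExp.eval_later (I : Input) (s : Store) (total node label below : NExp) :
    (later total node label below).eval I s =
      laterCount (node.eval I s) (total.eval I s) (label.eval I s, below.eval I s) := by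
  simp [later, laterCount, selfCount]

namespace Blk

/-- Combines the cost in the variable `current` with another cost. -/
def accumulate (e : RExp) : Blk :=
  branch .bottleneck (branch (.realLt (.var current) e) (letReal current e) skip)
    (letReal current (.add (.var current) e))

/-- Computes the cost `Table.choiceCost` of the choice `(row, col)` in the entry
`(node, inner, innermost)`. -/
def choiceCost : Blk :=
  letReal current (.connCost (.at point (.var node)) (.at point (.var row))) ;;
    branch (.pos (.isEq (.var row) (.var node)))
      (accumulate (.centerCost (.at point (.var node)))) skip ;;
    accumulate (.get tableValue (.at firstChild (.var node)) (.var col) (.var row)) ;;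
    accumulate (.get tableValue (.at firstChild (.at parent (.var node)))
      (.later (.var inner) (.var node) (.var row) (.var col)) (.var innermost))

/-- The test for `Allowed`, where the label of the parent is `innermost`. -/
def isAllowed : BExp :=
  .imp (.natLt (.isEq (.var row) (.var innermost)) (.lit 1))
    (.conj (.natLt (.get ancestor (.var node) (.var innermost) (.lit 0)) (.lit 1))
      (.pos (.get ancestor (.var node) (.var row) (.lit 0))))

/-- The test whether `(row, col)` is one of the `Table.choices` in the entry
`(node, inner, innermost)`. -/
def isChoice : BExp :=
  .conj (.conj (.pos (.var row)) (.natLe (.var row) .size))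
    (.conj isAllowed
      (.conj (.natLe (.add (.isEq (.var row) (.var node)) (.var col)) (.var inner))
        (.conj (.pos (.get tableFeas (.at firstChild (.var node)) (.var col) (.var row)))
          (.pos (.get tableFeas (.at firstChild (.at parent (.var node)))
            (.later (.var inner) (.var node) (.var row) (.var col)) (.var innermost))))))

/-- Computes the entry `(node, inner, innermost)` of the table. -/
def tableEntry : Blk :=
  search isChoice choiceCost ;;
    .setNat tableFeas (.var node) (.var inner) (.var innermost) (.var found) ;;
    .setNat tableLabel (.var node) (.var inner) (.var innermost) (.var bestRow) ;;
    .setNat tableBelow (.var node) (.var inner) (.var innermost) (.var bestCol) ;;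
    .setReal tableValue (.var node) (.var inner) (.var innermost) (.var best)

variable {I : Input} {s : Store} {pt par : ℕ → ℕ} {t j c : ℕ}

theorem exec_accumulate (e : RExp) : (accumulate e).exec I s =
    s.putReal (current, 0, 0, 0) (I.kind.op (s.rnum current) (e.eval I s)) := by
  cases hk : I.kind
  · simp [accumulate, exec, hk, Kind.op]
  · by_cases hlt : s.rnum current < e.eval I s
    · simp [accumulate, exec, hk, Kind.op, hlt, max_eq_right hlt.le]
    · simp [accumulate, exec, hk, Kind.op, hlt, max_eq_left (not_lt.1 hlt)]

theorem exec_choiceCost {i l : ℕ} (htree : s.HoldsTree I.size pt par) (ht : s.num node = t)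
    (hj : s.num Arr.inner = j) (hc : s.num innermost = c) (hi : s.num row = i)
    (hl : s.num col = l) (hfirst : s.vec firstChild = head I.size par (t + 1)) :
    (choiceCost.exec I s).rnum current =
      s.table.choiceCost I.size par I.kind.op (I.own pt) t j c (i, l) := by
  by_cases hit : i = t <;>
    simp [choiceCost, exec, exec_accumulate, Table.choiceCost, Input.own, Store.table, hit, ht, hj,
      hc, hi, hl, hfirst, htree.point, htree.parent]

theorem holds_isAllowed {i : ℕ} (htree : s.HoldsTree I.size pt par) (ht : s.num node = t)
    (htn : t ≤ I.size) (hc : s.num innermost = c) (hcn : c ≤ I.size) (hi : s.num row = i)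
    (hin : i ≤ I.size) : isAllowed.Holds I s ↔ Allowed par t c i := by
  have hsubc := htree.ancestor t htn c hcn
  rw [Nat.pos_iff_ne_zero, ← not_iff_not, not_not] at hsubc
  simp [isAllowed, ht, hc, hi, htree.ancestor t htn i hin, hsubc, Allowed, or_iff_not_imp_left]

theorem holds_isChoice {i l : ℕ} (htree : s.HoldsTree I.size pt par) (ht : s.num node = t)
    (htn : t ≤ I.size) (hj : s.num Arr.inner = j) (hc : s.num innermost = c) (hcn : c ≤ I.size)
    (hi : s.num row = i) (hl : s.num col = l)
    (hfirst : s.vec firstChild = head I.size par (t + 1)) :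
    isChoice.Holds I s ↔ (i, l) ∈ s.table.choices I.size par t j c := by
  have hallowed (hin : i ≤ I.size) := holds_isAllowed htree ht htn hc hcn hi hin
  by_cases hin : i ≤ I.size <;>
    simp [isChoice, Table.choices, Store.table, ht, hj, hc, hi, hl, hfirst, htree.parent,
      selfCount, hallowed, hin, Nat.one_le_iff_ne_zero, Nat.pos_iff_ne_zero]

theorem exec_tableEntry (htree : s.HoldsTree I.size pt par) (ht : s.num node = t)
    (htn : t ≤ I.size) (hj : s.num Arr.inner = j) (hjn : j ≤ I.size) (hc : s.num innermost = c)
    (hcn : c ≤ I.size) (hfirst : s.vec firstChild = head I.size par (t + 1)) :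
    s.table.BestEntry I.size par I.kind.op (I.own pt) (tableEntry.exec I s).table t j c ∧
      ∀ t' j' c', (t', j', c') ≠ (t, j, c) →
        s.table.AgreeAt (tableEntry.exec I s).table t' j' c' := by
  have hbest : SearchState _ _ ((search isChoice choiceCost).exec I s) :=
    exec_search (S := s.table.choices I.size par t j c)
      (F := s.table.choiceCost I.size par I.kind.op (I.own pt) t j c) (by decide) ?_ ?_ ?_
  · have hoff := exec_eqOff (I := I) (search isChoice choiceCost) s
    rw [tableEntry, exec_seq]
    rw [← hoff.num node] at ht
    rw [← hoff.num Arr.inner] at hj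
    rw [← hoff.num innermost] at hc
    rw [← hoff.table] at hbest ⊢
    generalize (search isChoice choiceCost).exec I s = s₁ at *
    refine ⟨?_, fun t' j' c' hne => ?_⟩
    · rw [SearchState] at hbest
      rw [Table.BestEntry]
      convert hbest using 2 <;> simp [Store.table, ht, hj, hc]
    · rw [ne_eq, Prod.ext_iff, Prod.ext_iff] at hne
      constructor <;> simp [Store.table, ht, hj, hc, hne]
  · rintro ⟨i, l⟩ ⟨hi, -, hle, -⟩
    exact ⟨hi.2, (Nat.le_of_add_left_le hle).trans hjn⟩
  · intro s' i l hoff hi hl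
    rw [← hoff.table]
    exact holds_isChoice (htree.of_eqOff hoff) ((hoff.num _).trans ht) htn
      ((hoff.num _).trans hj) ((hoff.num _).trans hc) hcn hi hl ((hoff.vec _).trans hfirst)
  · intro s' i l hoff hi hl _
    rw [← hoff.table]
    exact exec_choiceCost (htree.of_eqOff hoff) ((hoff.num _).trans ht)
      ((hoff.num _).trans hj) ((hoff.num _).trans hc) hi hl ((hoff.vec _).trans hfirst)

end Blk

namespace Blk

/-- Computes the row `node` of the table. -/
def tableRow : Blk := loop Arr.inner (loop innermost tableEntry)

/-- Computes the row `n + 1 - outer` of the table. -/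
def tableStep : Blk :=
  letNat node (.sub (.add .size (.lit 1)) (.var outer)) ;; tableRow ;;
    setAt firstChild (.at parent (.var node)) (.var node)

/-- Computes the rows of the table from the last position to the first one. -/
def tableRows : Blk := forEach outer tableStep

/-- The state of the dynamic program when the rows from `t` on are filled. -/
structure FilledFrom (I : Input) (pt par : ℕ → ℕ) (e : ℝ) (t : ℕ) (s : Store) : Prop where
  tree : s.HoldsTree I.size pt par
  first : s.vec firstChild = head I.size par t
  null : s.table.Null I.size e
  rows : ∀ r ∈ Set.Icc t I.size, s.table.Row I.size par I.kind.op (I.own pt) r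

variable {I : Input} {s : Store} {pt par : ℕ → ℕ} {t : ℕ}

theorem exec_tableRow (htree : s.HoldsTree I.size pt par) (ht : s.num node = t) (ht0 : t ≠ 0)
    (htn : t ≤ I.size) (hfirst : s.vec firstChild = head I.size par (t + 1)) :
    (∀ r ≠ t, ∀ j c, s.table.AgreeAt (tableRow.exec I s).table r j c) ∧
      (tableRow.exec I s).table.Row I.size par I.kind.op (I.own pt) t := by
  have hrow : ∀ {r}, r = 0 ∨ t < r → r ≠ t := by omega
  suffices key : (∀ r ≠ t, ∀ j c, s.table.AgreeAt (tableRow.exec I s).table r j c) ∧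
      ∀ x ∈ Set.Iic I.size ×ˢ Set.Iic I.size, s.table.BestEntry I.size par I.kind.op (I.own pt)
        (tableRow.exec I s).table t x.1 x.2 from
    ⟨key.1, fun j hj c hc =>
      (key.2 (j, c) ⟨hj, hc⟩).congr (fun r hr => key.1 r (hrow hr)) (.refl _ _ _ _)⟩
  refine exec_loop_loop_invariant (by decide) (fun T s' =>
    (∀ r ≠ t, ∀ j c, s.table.AgreeAt s'.table r j c) ∧
      ∀ x ∈ T, s.table.BestEntry I.size par I.kind.op (I.own pt) s'.table t x.1 x.2)
    (by simpa using fun r _ => Table.AgreeAt.refl s.table r) (fun _ _ _ h => h)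
    (fun _ _ _ h => h) fun j c T s₁ hjn hcn hj hc hoff _ ⟨hagree, hbest⟩ => ?_
  obtain ⟨hentry, hother⟩ := exec_tableEntry (htree.of_eqOff hoff) ((hoff.num _).trans ht) htn
    hj hjn hc hcn ((hoff.vec _).trans hfirst)
  refine ⟨fun r hr j' c' => (hagree r hr j' c').trans (hother r j' c' (by simp [hr])), ?_⟩
  rintro ⟨j', c'⟩ hx
  by_cases heq : (j', c') = (j, c)
  · obtain ⟨rfl, rfl⟩ := Prod.ext_iff.1 heq
    exact hentry.congr (fun r hr j c => (hagree r (hrow hr) j c).symm) (.refl _ _ _ _)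
  · exact (hbest _ (hx.resolve_left heq)).congr (fun r _ => .refl _ r)
      (hother t j' c' (by simpa using heq))

theorem FilledFrom.exec_tableStep {e : ℝ} {i : ℕ} (h : FilledFrom I pt par e (t + 1) s)
    (houter : s.num outer = i) (hi : t + i = I.size + 1) (ht0 : t ≠ 0) (htn : t ≤ I.size) :
    FilledFrom I pt par e t (tableStep.exec I s) := by
  rw [tableStep, exec_seq, exec_seq]
  set s₁ := (letNat node (.sub (.add .size (.lit 1)) (.var outer))).exec I s with hs₁
  have hnode : s₁.num node = t := by
    simp [hs₁, houter]
    omega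
  have htree₁ : s₁.HoldsTree I.size pt par := h.tree.of_eqOff (exec_eqOff _ _)
  have hfirst₁ : s₁.vec firstChild = head I.size par (t + 1) := by rw [← h.first]; rfl
  obtain ⟨hagree, hrow⟩ := exec_tableRow htree₁ hnode ht0 htn hfirst₁
  have hoff := exec_eqOff (I := I) tableRow s₁
  set s₂ := tableRow.exec I s₁
  have htree₂ : s₂.HoldsTree I.size pt par := htree₁.of_eqOff hoff
  refine ⟨htree₂.of_eqOff (exec_eqOff _ _), ?_, h.null.congr (hagree 0 ht0.symm), fun r hr => ?_⟩
  · rw [exec_setAt, NExp.eval_at, NExp.eval_var, hoff.num node, hnode, htree₂.parent,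
      Store.vec_putNat_self, hoff.vec firstChild, hfirst₁, head_eq_update par htn]
  · rcases eq_or_lt_of_le hr.1 with rfl | htr
    · exact hrow
    · exact fun j hj c hc => (h.rows r ⟨htr, hr.2⟩ j hj c hc).congr
        (fun r' hr' => hagree r' (by omega)) (hagree r htr.ne' j c)

theorem exec_tableRows {e : ℝ} (htree : s.HoldsTree I.size pt par) (hfirst : s.vec firstChild = 0)
    (hnull : s.table.Null I.size e) :
    (tableRows.exec I s).table.Correct I.size par I.kind.op e (I.own pt) := by
  suffices key : FilledFrom I pt par e (I.size + 2 - (I.size + 1)) (tableRows.exec I s) from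
    ⟨key.null, fun r hr => key.rows r ⟨by have := hr.1; omega, hr.2⟩⟩
  refine exec_forEach_invariant (fun i => FilledFrom I pt par e (I.size + 2 - i))
    ⟨htree, ?_, hnull, fun r hr => ?_⟩
    (fun i s' v h => ⟨h.tree.of_eqOff (Store.putNat_eqOff (L := [outer]) (by simp) _ _ _), by
      simpa using h.first, h.null, h.rows⟩)
    fun i s' hi houter _ h => ?_
  · funext p
    rw [hfirst, head_of_lt par p (by omega), Pi.zero_apply]
  · exact absurd (hr.1.trans hr.2) (by omega)
  · have h1 := hi.1
    have h2 := hi.2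
    rw [show I.size + 2 - i = I.size + 2 - (i + 1) + 1 by omega] at h
    exact h.exec_tableStep houter (by omega) (by omega) (by omega)

end Blk

/-! ## Reading off the clustering -/

/-- The number of centers of a labeling that are less than `t`. -/
def centerRank (φ : ℕ → ℕ) (t : ℕ) : ℕ := {r ∈ Finset.Ico 1 t | φ r = r}.card

theorem centerRank_succ {φ : ℕ → ℕ} {t : ℕ} (ht : 1 ≤ t) :
    centerRank φ (t + 1) = centerRank φ t + if φ t = t then 1 else 0 := by
  simp only [centerRank, Finset.card_filter, Finset.sum_Ico_succ_top ht]

theorem centerRank_lt_centerRank {φ : ℕ → ℕ} {t t' : ℕ} (ht : 1 ≤ t) (hφ : φ t = t)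
    (htt' : t < t') : centerRank φ t < centerRank φ t' := by
  rw [← Nat.succ_le_iff, Nat.succ_eq_add_one, ← if_pos (c := φ t = t) hφ (t := 1) (e := 0),
    ← centerRank_succ ht]
  exact Finset.card_le_card (Finset.filter_subset_filter _ (Finset.Ico_subset_Ico_right htt'))

theorem injOn_centerRank (φ : ℕ → ℕ) : Set.InjOn (centerRank φ) {t | 1 ≤ t ∧ φ t = t} :=
  StrictMonoOn.injOn fun _ ht _ _ htt' => centerRank_lt_centerRank ht.1 ht.2 htt'

theorem centerRank_lt_centerCount {n t : ℕ} {φ : ℕ → ℕ} (ht : t ∈ Set.Icc 1 n) (hφ : φ t = t) :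
    centerRank φ t < centerCount n φ :=
  (centerRank_lt_centerRank ht.1 hφ (Nat.lt_succ_of_le ht.2)).trans_eq
    (centerCount_eq_card n φ).symm

namespace Blk

/-- Computes the label of the position `outer` from the table, and the numbers of centers that
remain for its children and for its later siblings. -/
def labelStep : Blk :=
  setAt label (.var outer) (.get tableLabel (.var outer)
    (.at remaining (.at parent (.var outer))) (.at label (.at parent (.var outer)))) ;;
  setAt remaining (.var outer) (.get tableBelow (.var outer)
    (.at remaining (.at parent (.var outer))) (.at label (.at parent (.var outer)))) ;;
  setAt remaining (.at parent (.var outer)) (.later (.at remaining (.at parent (.var outer)))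
    (.var outer) (.at label (.var outer)) (.at remaining (.var outer)))

/-- Computes the labels of the positions from the table. -/
def labels : Blk := setAt remaining (.lit 0) .clusters ;; forEach outer labelStep

/-- Computes `centerRank φ`, where `φ` is the array `label`. -/
def ranks : Blk :=
  forEach outer (setAt rank (.add (.var outer) (.lit 1))
    (.add (.at rank (.var outer)) (.isEq (.at label (.var outer)) (.var outer))))

/-- Numbers the clusters in the order of their centers. -/
def outputs : Blk :=
  forEach outer (setAt output (.at point (.var outer)) (.at rank (.at label (.var outer))))

variable {I : Input} {s : Store} {pt par : ℕ → ℕ} {t : ℕ}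

theorem exec_labelStep (ht : s.num outer = t) (hpar : s.vec parent t ≠ t) {x : ℕ × ℕ}
    (hx : x = (s.table.label t (s.vec remaining (s.vec parent t)) (s.vec label (s.vec parent t)),
      s.table.below t (s.vec remaining (s.vec parent t)) (s.vec label (s.vec parent t)))) :
    (labelStep.exec I s).vec label = Function.update (s.vec label) t x.1 ∧
      (labelStep.exec I s).vec remaining =
        Function.update (Function.update (s.vec remaining) t x.2) (s.vec parent t)
          (laterCount t (s.vec remaining (s.vec parent t)) x) := by
  subst hx
  simp [labelStep, ht, hpar, Store.table]

theorem exec_labels {e : ℝ} (he : I.kind.op e e = e) (htree : s.HoldsTree I.size pt par)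
    (hroot : IsRootedTree I.size par)
    (hB : s.table.Correct I.size par I.kind.op e (I.own pt)) (hlabel : s.vec label = 0)
    (hk : I.clusters ≤ I.size) (hfeas : s.table.feas (head I.size par 1 0) I.clusters 0) :
    IsOptimalLabeling I.size par I.kind.op e (I.own pt) I.clusters
      ((labels.exec I s).vec label) := by
  suffices key : s.table.PartialLabeling I.size par I.kind.op e (I.own pt) I.clusters (I.size + 1)
      ((labels.exec I s).vec remaining) ((labels.exec I s).vec label) from
    key.isOptimalLabeling hk I.kind.op_mono he hB hroot
  refine exec_forEach_invariant (fun t s' => s.table.PartialLabeling I.size par I.kind.op e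
    (I.own pt) I.clusters t (s'.vec remaining) (s'.vec label)) (.init he hfeas ?_ ?_)
    (fun t s' v h => by simpa using h) fun t s' ht hcount hoff hP => ?_
  · simp
  · simp [hlabel]
  · have hpar : s'.vec parent = par := (hoff.vec parent).trans htree.parent
    have htable : s'.table = s.table := hoff.table
    have hlt := hroot.par_lt t (Nat.ne_of_gt ht.1)
    obtain ⟨h₁, h₂⟩ := exec_labelStep (I := I) hcount (by rw [hpar]; exact hlt.ne) rfl
    rw [h₁, h₂, hpar, htable]
    exact hP.step hB hroot ht hk

theorem exec_ranks (hrank : s.vec rank = 0) {φ : ℕ → ℕ} (hφ : s.vec label = φ) :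
    ∀ t ∈ Set.Icc 1 (I.size + 1), (ranks.exec I s).vec rank t = centerRank φ t := by
  refine exec_forEach_invariant
    (fun i s' => ∀ t ∈ Set.Icc 1 i, s'.vec rank t = centerRank φ t) ?_
    (fun t s' v h => by simpa using h) fun i s' hi hcount hoff h t ht => ?_
  · simp [hrank, centerRank]
  · have hlabel := (hoff.vec label).trans hφ
    rcases eq_or_lt_of_le ht.2 with rfl | hlt
    · simpa [hcount, hlabel, centerRank_succ hi.1] using h i (Set.right_mem_Icc.2 hi.1)
    · have hti := Nat.lt_succ_iff.1 hlt
      simpa [hcount, hlt.ne] using h t ⟨ht.1, hti⟩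

theorem exec_outputs (hinj : Set.InjOn (s.vec point) (Set.Icc 1 I.size)) :
    ∀ t ∈ Set.Icc 1 I.size,
      (outputs.exec I s).vec output (s.vec point t) = s.vec rank (s.vec label t) := by
  suffices key : ∀ t ∈ Set.Ico 1 (I.size + 1),
      (outputs.exec I s).vec output (s.vec point t) = s.vec rank (s.vec label t) from
    fun t ht => key t ⟨ht.1, Nat.lt_succ_of_le ht.2⟩
  refine exec_forEach_invariant (fun i s' => ∀ t ∈ Set.Ico 1 i,
    s'.vec output (s.vec point t) = s.vec rank (s.vec label t)) (by simp)
    (fun t s' v h => by simpa using h) fun i s' hi hcount hoff h t ht => ?_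
  rw [exec_setAt, NExp.eval_at, NExp.eval_at, NExp.eval_at, NExp.eval_var, hcount,
    hoff.vec point, hoff.vec rank, hoff.vec label, Store.vec_putNat_self]
  rcases eq_or_lt_of_le (Nat.lt_succ_iff.1 ht.2) with rfl | hlt
  · rw [Function.update_self]
  · rw [Function.update_of_ne (hinj.ne ⟨ht.1, hlt.le.trans hi.2⟩ hi hlt.ne), h t ⟨ht.1, hlt⟩]

end Blk

theorem Input.IsNullValue.op_self {I : Input} {e : ℝ} (h : I.IsNullValue e) :
    I.kind.op e e = e := by
  cases hk : I.kind
  · rw [h.total hk, Kind.op, add_zero]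
  · exact max_self e

namespace Blk

/-- The preparations, and the computation of the table. -/
def fillTable : Blk := nullCost ;; prim ;; ancestors ;; nullRow ;; tableRows

/-- The clustering algorithm. -/
def clustering : Blk := fillTable ;; labels ;; ranks ;; outputs

theorem wellFormed_clustering : clustering.WellFormed := by
  simp only [clustering, fillTable, nullCost, prim, shortestEdge, ancestors, ancestorEntry, nullRow,
    tableRows, tableStep, tableRow, tableEntry, search, record, compare, choiceCost, accumulate,
    labels, labelStep, ranks, outputs, forEach, letNat, setAt, letReal, WellFormed, writes]
  simp

variable {I : Input}

theorem exec_fillTable : ∃ pt par e, IsPrimRun I.size I.dist (I.size + 1) pt par ∧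
    I.IsNullValue e ∧ (fillTable.exec I .init).HoldsTree I.size pt par ∧
    (fillTable.exec I .init).table.Correct I.size par I.kind.op e (I.own pt) := by
  have hnull : I.IsNullValue ((nullCost.exec I .init).rnum nullValue) := exec_nullCost rfl
  have hoff₁ := exec_eqOff (I := I) nullCost .init
  simp only [fillTable, exec_seq]
  set s₁ := nullCost.exec I .init
  have hrun := exec_prim (I := I) (hoff₁.vec parent) (hoff₁.vec mark)
  have hoff₂ := exec_eqOff (I := I) prim s₁
  set s₂ := prim.exec I s₁
  have htree₃ := exec_ancestors hrun.isRootedTree rfl (hrun.par_eq_zero 0 (by simp)) fun x => by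
    rw [(hoff₂ ancestor (by decide) x).1, (hoff₁ ancestor (by decide) x).1]
    rfl
  have hoff₃ := exec_eqOff (I := I) ancestors s₂
  set s₃ := ancestors.exec I s₂
  have hnull₄ := exec_nullRow (I := I) (s := s₃)
  rw [hoff₃.rnum nullValue, hoff₂.rnum nullValue] at hnull₄
  have hoff₄ := exec_eqOff (I := I) nullRow s₃
  set s₄ := nullRow.exec I s₃
  have htree₄ := htree₃.of_eqOff hoff₄
  have hfirst₄ : s₄.vec firstChild = 0 := by
    rw [hoff₄.vec firstChild, hoff₃.vec firstChild, hoff₂.vec firstChild, hoff₁.vec firstChild]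
    rfl
  exact ⟨_, _, _, hrun, hnull, htree₄.of_eqOff (exec_eqOff tableRows s₄),
    exec_tableRows htree₄ hfirst₄ hnull₄⟩

theorem exec_clustering : ∃ pt par e, IsPrimRun I.size I.dist (I.size + 1) pt par ∧
    I.IsNullValue e ∧ ∀ ψ, IsTreeLabeling I.size par ψ → centerCount I.size ψ = I.clusters →
      ∃ φ, IsOptimalLabeling I.size par I.kind.op e (I.own pt) I.clusters φ ∧
        ∀ t ∈ Set.Icc 1 I.size,
          (clustering.exec I .init).vec output (pt t) = centerRank φ (φ t) := by
  obtain ⟨pt, par, e, hrun, hnull, htree, hB⟩ := exec_fillTable (I := I)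
  refine ⟨pt, par, e, hrun, hnull, fun ψ hψ hψk => ?_⟩
  have hroot := hrun.isRootedTree
  have hoff₁ := exec_eqOff (I := I) fillTable .init
  simp only [clustering, exec_seq]
  set s₁ := fillTable.exec I .init
  have hopt := exec_labels hnull.op_self htree hroot hB (hoff₁.vec label)
    (hψk ▸ sum_selfCount_le ψ le_rfl)
    (hψk ▸ (hB.le_labelCost I.kind.op_mono hnull.op_self hroot hψ).1)
  have hoff₂ := exec_eqOff (I := I) labels s₁
  set s₂ := labels.exec I s₁
  have hrank := exec_ranks (I := I) ((hoff₂.vec rank).trans (hoff₁.vec rank)) rfl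
  have hoff₃ := exec_eqOff (I := I) ranks s₂
  set s₃ := ranks.exec I s₂
  have hpoint : s₃.vec point = pt := by
    rw [hoff₃.vec point, hoff₂.vec point, htree.point]
  refine ⟨_, hopt, fun t ht => ?_⟩
  have hlabel := hopt.isTreeLabeling.mem t ht
  have hinj : Set.InjOn pt (Set.Icc 1 I.size) := by
    simpa only [Set.Ico_add_one_right_eq_Icc] using hrun.injOn
  rw [← hpoint, exec_outputs (hpoint ▸ hinj) t ht, hoff₃.vec label,
    hrank _ ⟨hlabel.1, hlabel.2.trans (Nat.le_succ _)⟩]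

end Blk

/-! ## Correctness of the algorithm -/

section Fold

variable {α : Type*}

theorem fold_total (s : Finset α) (e : ℝ) (F : α → ℝ) :
    s.fold Kind.total.op e F = e + ∑ i ∈ s, F i := by
  induction s using Finset.cons_induction with
  | empty => simp
  | cons a s ha ih => rw [Finset.fold_cons ha, ih, Finset.sum_cons ha, Kind.op, add_left_comm]

theorem fold_bottleneck_le (s : Finset α) (e x : ℝ) (F : α → ℝ) :
    s.fold Kind.bottleneck.op e F ≤ x ↔ e ≤ x ∧ ∀ i ∈ s, F i ≤ x := by
  induction s using Finset.cons_induction with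
  | empty => simp
  | cons a s ha ih =>
    rw [Finset.fold_cons ha, Finset.forall_mem_cons, Kind.op, max_le_iff, ih, and_left_comm]

end Fold

/-- `pos u` is the position of the point `u` in the sequence `pt 1, …, pt n` of all points. -/
structure IsPositionMap {n : ℕ} (pt : ℕ → ℕ) (pos : Fin n → ℕ) : Prop where
  range_eq : Set.range pos = Set.Icc 1 n
  pt_pos : ∀ u, pt (pos u) = u

section Positions

variable {n k : ℕ} {pt par φ : ℕ → ℕ} {pos : Fin n → ℕ} {m : Fin n → Fin n}

theorem IsPrimRun.exists_isPositionMap {D : ℕ → ℕ → ℝ} (h : IsPrimRun n D (n + 1) pt par) :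
    ∃ pos : Fin n → ℕ, IsPositionMap pt pos := by
  have hsurj : Set.SurjOn pt (Finset.Ico 1 (n + 1)) (Finset.range n) :=
    Finset.surjOn_of_injOn_of_card_le pt
      (fun t ht => Finset.mem_coe.2 (Finset.mem_range.2 (h.pt_lt t (by simpa using ht))))
      (by simpa using h.injOn) (by simp)
  choose pos hmem hpt using fun u : Fin n => hsurj (Finset.mem_coe.2 (Finset.mem_range.2 u.2))
  have hIco : ∀ {t}, t ∈ Set.Icc 1 n → t ∈ Set.Ico 1 (n + 1) :=
    fun ht => ⟨ht.1, Nat.lt_succ_of_le ht.2⟩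
  have hIcc : ∀ u, pos u ∈ Set.Icc 1 n := fun u => by
    have := hmem u
    simp only [Finset.coe_Ico, Set.mem_Ico] at this
    exact ⟨this.1, Nat.le_of_lt_succ this.2⟩
  refine ⟨pos, (Set.range_subset_iff.2 hIcc).antisymm fun t ht => ?_, hpt⟩
  exact ⟨⟨pt t, h.pt_lt t (hIco ht)⟩, h.injOn (hIco (hIcc _)) (hIco ht) (hpt _)⟩

namespace IsPositionMap

variable (h : IsPositionMap pt pos)
include h

theorem mem (u : Fin n) : pos u ∈ Set.Icc 1 n := h.range_eq ▸ Set.mem_range_self u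

theorem injective : Function.Injective pos := fun u v huv =>
  Fin.ext (by rw [← h.pt_pos u, ← h.pt_pos v, huv])

theorem forall_mem_Icc {P : ℕ → Prop} : (∀ t ∈ Set.Icc 1 n, P t) ↔ ∀ u, P (pos u) := by
  rw [← h.range_eq, Set.forall_mem_range]

theorem map_univ : Finset.univ.map ⟨pos, h.injective⟩ = Finset.Ico 1 (n + 1) := by
  rw [← Finset.coe_inj]
  simpa [Set.Ico_add_one_right_eq_Icc] using h.range_eq

theorem centerCount_eq (hφ : ∀ u, φ (pos u) = pos (m u)) :
    centerCount n φ = (Finset.univ.filter fun u => m u = u).card := by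
  simp [centerCount_eq_card, ← h.map_univ, Finset.filter_map, hφ, h.injective.eq_iff]

theorem own_eq (k : ℕ) (R : CostData n) (d : Fin n → Fin n → ℝ) (u c : Fin n) :
    (instanceInput k R d).own pt (pos u) (pos c) = R.own d u c := by
  simp [Input.own, CostData.own, h.pt_pos, h.injective.eq_iff, instanceInput]

theorem labelCost_eq_fold (k : ℕ) (R : CostData n) (d : Fin n → Fin n → ℝ) (e : ℝ)
    (hφ : ∀ u, φ (pos u) = pos (m u)) :
    labelCost n R.kind.op e ((instanceInput k R d).own pt) φ =
      Finset.univ.fold R.kind.op e fun u => R.own d u (m u) := by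
  rw [labelCost, ← h.map_univ, Finset.fold_map]
  simp only [Function.comp_def, Function.Embedding.coeFn_mk, hφ, h.own_eq]

theorem labelCost_eq_mapCost (hn : 0 < n) {R : CostData n} {d : Fin n → Fin n → ℝ} {e : ℝ}
    (he : (instanceInput k R d).IsNullValue e) (hφ : ∀ u, φ (pos u) = pos (m u)) :
    labelCost n R.kind.op e ((instanceInput k R d).own pt) φ = R.mapCost m d := by
  rw [h.labelCost_eq_fold k R d e hφ, CostData.mapCost]
  cases hκ : R.kind
  · rw [fold_total, he.total hκ, zero_add]
  · let u₀ : Fin n := ⟨0, hn⟩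
    have : Nonempty (Fin n) := ⟨u₀⟩
    have hle : e ≤ R.own d u₀ (m u₀) := by
      have hg : e ≤ R.g u₀ (d u₀ (m u₀)) := by
        simpa [instanceInput] using he.bottleneck hκ u₀ u₀.2.le (m u₀) (m u₀).2.le
      exact hg.trans ((own_le_iff_of_bottleneck hκ).1 le_rfl).1
    refine eq_of_forall_ge_iff fun x => ?_
    rw [fold_bottleneck_le, ciSup_le_iff_of_finite]
    simp only [Finset.mem_univ, true_imp_iff]
    exact ⟨And.right, fun hx => ⟨hle.trans (hx u₀), hx⟩⟩

theorem exists_map (hφ : ∀ t ∈ Set.Icc 1 n, φ t ∈ Set.Icc 1 n) :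
    ∃ m : Fin n → Fin n, ∀ u, φ (pos u) = pos (m u) := by
  have hrange : ∀ u, φ (pos u) ∈ Set.range pos := fun u => h.range_eq ▸ hφ _ (h.mem u)
  choose m hm using hrange
  exact ⟨m, fun u => (hm u).symm⟩

theorem isCenterMap (htree : IsRootedTree n par) (hφ : IsTreeLabeling n par φ)
    (hφm : ∀ u, φ (pos u) = pos (m u)) : IsCenterMap (centerCount n φ) m where
  idem u := h.injective (by rw [← hφm, ← hφm, hφ.idem htree (h.mem u)])
  card := (h.centerCount_eq hφm).symm

end IsPositionMap

theorem IsCenterMap.isClustering {C : Fin n → Fin k} (hm : IsCenterMap k m)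
    (hker : ∀ u v, C u = C v ↔ m u = m v) : IsClustering C := by
  have hinj : Function.Injective fun x : {u // m u = u} => C x.1 := fun x y hxy =>
    Subtype.ext (by rw [← x.2, ← y.2]; exact (hker _ _).1 hxy)
  have hbij := (Fintype.bijective_iff_injective_and_card _).2
    ⟨hinj, by rw [Fintype.card_subtype, hm.card, Fintype.card_fin]⟩
  exact fun i => (hbij.2 i).imp' _ fun _ => id

theorem IsPositionMap.exists_clustering (h : IsPositionMap pt pos) (htree : IsRootedTree n par)
    (hφ : IsTreeLabeling n par φ) (hk : centerCount n φ = k) (hm : IsCenterMap k m)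
    (hφm : ∀ u, φ (pos u) = pos (m u)) :
    ∃ C : Fin n → Fin k, (∀ u, centerRank φ (φ (pos u)) = C u) ∧ IsClustering C ∧
      ∀ u v, C u = C v ↔ m u = m v := by
  have hidem : ∀ u, φ (φ (pos u)) = φ (pos u) := fun u => hφ.idem htree (h.mem u)
  have hmem : ∀ u, φ (pos u) ∈ Set.Icc 1 n := fun u => hφ.mem _ (h.mem u)
  let C : Fin n → Fin k := fun u =>
    ⟨centerRank φ (φ (pos u)), hk ▸ centerRank_lt_centerCount (hmem u) (hidem u)⟩
  have hker : ∀ u v, C u = C v ↔ m u = m v := fun u v => by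
    rw [Fin.mk.injEq, (injOn_centerRank φ).eq_iff ⟨(hmem u).1, hidem u⟩ ⟨(hmem v).1, hidem v⟩,
      hφm, hφm, h.injective.eq_iff]
  exact ⟨C, fun u => rfl, hm.isClustering hker, hker⟩

end Positions

section Resilient

variable {n k : ℕ} {d : Fin n → Fin n → ℝ} {R : CostData n} {C : Fin n → Fin k}
  {pt par : ℕ → ℕ} {pos : Fin n → ℕ}

theorem isMetricPerturbation_self (hd : IsMetric d) {α : ℝ} (hα : 1 ≤ α) :
    IsMetricPerturbation α d d :=
  ⟨hd, fun u v => ⟨le_rfl, le_mul_of_one_le_left (hd.nonneg u v) hα⟩⟩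

theorem IsMetric.instanceInput_dist_comm (hd : IsMetric d) (k : ℕ) (R : CostData n) (u v : ℕ) :
    (instanceInput k R d).dist u v = (instanceInput k R d).dist v u := by
  simp only [instanceInput, and_comm (a := v < n)]
  split_ifs
  exacts [hd.symm _ _, rfl]

theorem IsMapResilient.isTreeLabeling (h : IsMapResilient 2 R d C)
    (hrun : IsPrimRun n (instanceInput k R d).dist (n + 1) pt par) (hpos : IsPositionMap pt pos)
    {m : Fin n → Fin n} (hm : ∀ u, m (m u) = m u) (hker : ∀ u v, C u = C v ↔ m u = m v) :
    IsTreeLabeling n par (Function.extend pos (fun u => pos (m u)) 0) := by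
  obtain ⟨hub, hub_eq, hub_lt⟩ := h.exists_hubs
  have hext {β : Type} (F : Fin n → β) (j : ℕ → β) (u : Fin n) :
      Function.extend pos F j (pos u) = F u := hpos.injective.extend_apply F j u
  have hdist (u v : Fin n) : (instanceInput k R d).dist (pt (pos u)) (pt (pos v)) = d u v := by
    simp [instanceInput, hpos.pt_pos]
  refine isTreeLabeling_of_hubs hrun.isRootedTree
    (fun x y => h.metric.instanceInput_dist_comm k R _ _) hrun.isGreedyTree
    (κ := Function.extend pos (fun u => some (C u)) fun _ => none)
    (hub := Function.extend pos (fun u => pos (hub u)) 0) ?_ ?_ ?_ ?_ ?_ ?_ ?_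
  · exact Function.extend_apply' _ _ _ fun ⟨u, hu⟩ => by simpa [hu] using hpos.mem u
  all_goals simp only [hpos.forall_mem_Icc, hext, hdist, Option.some.injEq]
  · exact fun u => hpos.mem _
  · exact fun u => (hker _ _).2 (hm u)
  · exact fun u v huv => congrArg pos ((hker u v).1 huv)
  · exact fun u => hpos.mem _
  · exact fun u v huv => congrArg pos (hub_eq u v huv)
  · exact fun u v huv => hub_lt u v fun h' => huv (congrArg some h')

theorem IsMapResilient.isOptimalMap_of_isOptimalLabeling (h : IsMapResilient 2 R d C) (hn : 0 < n)
    (hrun : IsPrimRun n (instanceInput k R d).dist (n + 1) pt par) (hpos : IsPositionMap pt pos)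
    {e : ℝ} (he : (instanceInput k R d).IsNullValue e) {φ : ℕ → ℕ} {m m₀ : Fin n → Fin n}
    (hφ : IsOptimalLabeling n par R.kind.op e ((instanceInput k R d).own pt) k φ)
    (hφm : ∀ u, φ (pos u) = pos (m u)) (hm₀ : IsOptimalMap R k d m₀) : IsOptimalMap R k d m := by
  refine ⟨hφ.centerCount_eq ▸ hpos.isCenterMap hrun.isRootedTree hφ.isTreeLabeling hφm,
    fun m' hm' => (le_trans ?_ (hm₀.2 m' hm'))⟩
  have hker := h.ker d (isMetricPerturbation_self h.metric one_le_two) m₀ hm₀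
  have hψ := h.isTreeLabeling hrun hpos hm₀.1.idem hker
  have hψm := hpos.injective.extend_apply (fun u => pos (m₀ u)) 0
  rw [← hpos.labelCost_eq_mapCost hn he hφm, ← hpos.labelCost_eq_mapCost hn he hψm]
  exact hφ.labelCost_le _ hψ ((hpos.centerCount_eq hψm).trans hm₀.1.card)

theorem IsMapResilient.outputs_clustering (h : IsMapResilient 2 R d C) (hk : 0 < k) :
    ∃ C' : Fin n → Fin k, Outputs (Blk.clustering.exec (instanceInput k R d) .init) C' ∧
      IsClustering C' ∧ ∃ m, IsOptimalMap R k d m ∧ ∀ u v, C' u = C' v ↔ m u = m v := by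
  obtain ⟨m₀, hm₀, -⟩ := h.voronoi d h.metric
  have hn : 0 < n := by
    obtain ⟨u, -⟩ := Finset.card_pos.1 (hm₀.1.card.symm ▸ hk)
    exact u.pos
  obtain ⟨pt, par, e, hrun, he, hmain⟩ := Blk.exec_clustering (I := instanceInput k R d)
  obtain ⟨pos, hpos⟩ := hrun.exists_isPositionMap (n := n)
  have hker := h.ker d (isMetricPerturbation_self h.metric one_le_two) m₀ hm₀
  obtain ⟨φ, hφ, hout⟩ := hmain _ (h.isTreeLabeling hrun hpos hm₀.1.idem hker)
    ((hpos.centerCount_eq (hpos.injective.extend_apply _ _)).trans hm₀.1.card)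
  obtain ⟨m, hφm⟩ := hpos.exists_map hφ.isTreeLabeling.mem
  have hm := h.isOptimalMap_of_isOptimalLabeling hn hrun hpos he hφ hφm hm₀
  obtain ⟨C', hC', hclust, hker'⟩ := hpos.exists_clustering (k := k) hrun.isRootedTree
    hφ.isTreeLabeling hφ.centerCount_eq hm.1 hφm
  refine ⟨C', fun u => ?_, hclust, m, hm, hker'⟩
  have hu := (hout _ (hpos.mem u)).trans (hC' u)
  rwa [hpos.pt_pos] at hu

theorem outputs_clustering {H : Objective n k} (hk : 0 < k) (hd : IsMetric d)
    (hH : IsNaturalWith H R) (hres : IsMetricPerturbationResilient 2 H d) :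
    ∃ C : Fin n → Fin k, Outputs (Blk.clustering.exec (instanceInput k R d) .init) C ∧
      IsOptimal H d C ∧ ∀ C', IsOptimal H d C' → SamePartition C C' := by
  obtain ⟨C₀, hC₀⟩ := exists_isMapResilient hk hd hH hres
  obtain ⟨C, hout, hC, m, hm, hker⟩ := hC₀.outputs_clustering hk
  have hopt := hm.isOptimal hk (fun C hC => hH.eq_objective C d hC hd) hC hker
  refine ⟨C, hout, hopt, fun C' hC' u v => ?_⟩
  obtain ⟨C₁, -, hC₁⟩ := hres
  have hunique := (hC₁ d (isMetricPerturbation_self hd one_le_two)).2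
  rw [← hunique C hopt u v, hunique C' hC' u v]

end Resilient

end Clustering

theorem theorem1 :
    (∃ (P : Prog) (T : Polynomial ℕ),
      ∀ (n k : ℕ) (d : Fin n → Fin n → ℝ) (H : Objective n k) (R : CostData n),
        0 < k → IsMetric d → IsNaturalWith H R → IsMetricPerturbationResilient 2 H d →
        ∃ (s : Store) (t : ℕ), Runs (instanceInput k R d) P Store.init s t ∧ t ≤ T.eval n ∧
          ∃ C : Fin n → Fin k, Outputs s C ∧ IsOptimal H d C ∧
            ∀ C', IsOptimal H d C' → SamePartition C C') ∧
    (∀ n k : ℕ, 0 < k → k ≤ n →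
      IsNaturalCenterBased (kMeans n k) ∧ IsNaturalCenterBased (kMedian n k) ∧
      IsNaturalCenterBased (kCenter n k) ∧
      ∀ f : Fin n → ℝ, IsNaturalCenterBased (facilityLocation f k)) := by
  refine ⟨⟨Blk.clustering.compile, Blk.clustering.bound, fun n k d H R hk hd hH hres => ?_⟩,
    fun n k hk hkn => ⟨isNaturalCenterBased_kMeans hk hkn, isNaturalCenterBased_kMedian hk hkn,
      isNaturalCenterBased_kCenter hk hkn, isNaturalCenterBased_facilityLocation hk hkn⟩⟩
  obtain ⟨t, hrun, ht⟩ := Blk.runs_exec (I := instanceInput k R d) Blk.wellFormed_clustering .init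
  exact ⟨_, t, hrun, ht, outputs_clustering hk hd hH hres⟩
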